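/- Let $\dot x = Ax + Bu$, $y = Cx + Du$ be a real linear system. Let the state be partitioned into $n$ blocks of sizes $k_1,\dots,k_n\ge 1$, the input into $n_i$ blocks and the output into $n_o$ blocks. Write $A_{ij}, B_{il}, C_{ki}, D_{kl}$ for the corresponding blocks and assume that every diagonal block $A_{ii}$ is Hurwitz (all eigenvalues have negative real part). For a stable transfer function put $\|G\|_{\mathcal H_\infty}=\sup_{\omega\in\mathbb R}\|G(\mathrm i\omega)\|_2$, where $\|\cdot\|_2=\overline\sigma(\cdot)$ is the largest singular value, and let $\mu_2(X)$ be the largest eigenvalue of $(X+X^{\mathsf T})/2$. Define the $n\times n$ matrices $$\widetilde{\mathcal M}^\alpha_{ij}(A)=\begin{cases}-\|(sI-A_{ii})^{-1}\|_{\mathcal H_\infty}^{-1}, & i=j,\\ \|A_{ij}\|_2, & i\neq j,\end{cases}\qquad \mathcal N^\alpha_{ij}(A)=\begin{cases}\min\{\mu_2(A_{ii}),0\}, & i=j,\\ \|A_{ij}\|_2, & i\ne j.\end{cases}$$ Let $\widetilde F=\widetilde{\mathcal M}^\alpha(A)$ or $\widetilde F=\mathcal N^\alpha(A)$, and let $\widetilde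 G_{il}=\|B_{il}\|_2$, $H_{kj}=\|C_{kj}\|_2$, $J_{kl}=\|D_{kl}\|_2$. Suppose that $\widetilde F$ is Hurwitz and $$\|H(sI-\widetilde F)^{-1}\widetilde G+J\|_{\mathcal H_\infty}<\delta .$$ Then the following hold. (1) Let $\mathcal K_i=\{k:\ C_{ki}\ne0\}$, $\mathcal L_i=\{l:\ B_{il}\neq 0\}$, $\mathcal I_i=\{j\ne i:\ A_{ij}\neq 0\}$. There exist symmetric matrices $P_i\succ0$ and $\Xi_{ki},\Gamma_{il},\Phi_{ij},\Upsilon_{kl},\Lambda_{kl}\succeq0$ of compatible sizes, with $\Xi_{ki}\succ0$ for $k\in\mathcal K_i$, $\Gamma_{il}\succ0$ for $l\in\mathcal L_i$ and $\Phi_{ij}\succ0$ for $j\in\mathcal I_i$, such that $$P_iA_{ii}+A_{ii}^{\mathsf T}P_i+\sum_{j\ne i}\Phi_{ji}+\sum_{k\in\mathcal K_i}C_{ki}^{\mathsf T}\Xi_{ki}^{-1}C_{ki}+P_i\Bigl(\sum_{j\in\mathcal I_i}A_{ij}\Phi_{ij}^{-1}A_{ij}^{\mathsf T}+\sum_{l\in\mathcal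 L_i}B_{il}\Gamma_{il}^{-1}B_{il}^{\mathsf T}\Bigr)P_i\prec0\quad\forall i,$$ $$\begin{bmatrix}\Upsilon_{kl}&-D_{kl}^{\mathsf T}\\-D_{kl}&\Lambda_{kl}\end{bmatrix}\succeq0\quad\forall k,l,\qquad \sum_i\Xi_{ki}+\sum_l\Lambda_{kl}\preceq I\quad\forall k,\qquad \sum_i\Gamma_{il}+\sum_k\Upsilon_{kl}\prec\delta^2I\quad\forall l.$$ (2) $A$ is Hurwitz, $\|C(sI-A)^{-1}B+D\|_{\mathcal H_\infty}<\delta$, $\overline\sigma(D)<\delta$ (so that $D^{\mathsf T}D-\delta^2I$ is invertible), and there exist $P_i\succ0$ such that the block-diagonal matrix $P=\operatorname{diag}(P_1,\dots,P_n)$ satisfies the Riccati inequality $$PA+A^{\mathsf T}P+C^{\mathsf T}C-(PB+C^{\mathsf T}D)(D^{\mathsf T}D-\delta^2I)^{-1}(D^{\mathsf T}C+B^{\mathsf T}P)\prec0 .$$ -/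

import Mathlib

-- `‖X‖` for a matrix `X` is the spectral norm, i.e. the largest singular value.
open scoped Matrix Matrix.Norms.L2Operator

noncomputable section

namespace BlockRiccati

/-- A real square matrix is Hurwitz if all its (complex) eigenvalues have negative real part. -/
def IsHurwitz {ι : Type*} [Fintype ι] [DecidableEq ι] (A : Matrix ι ι ℝ) : Prop :=
  ∀ z ∈ spectrum ℂ (A.map Complex.ofReal), z.re < 0

/-- The resolvent `s ↦ (s I - A)⁻¹` of a real square matrix. -/
def resolventFun {ι : Type*} [Fintype ι] [DecidableEq ι] (A : Matrix ι ι ℝ) (s : ℂ) :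
    Matrix ι ι ℂ :=
  (s • (1 : Matrix ι ι ℂ) - A.map Complex.ofReal)⁻¹

/-- The transfer function `s ↦ C (s I - A)⁻¹ B + D` of `x' = A x + B u`, `y = C x + D u`. -/
def transferFun {ι μ π : Type*} [Fintype ι] [DecidableEq ι]
    (A : Matrix ι ι ℝ) (B : Matrix ι μ ℝ) (C : Matrix π ι ℝ) (D : Matrix π μ ℝ) (s : ℂ) :
    Matrix π μ ℂ :=
  C.map Complex.ofReal * resolventFun A s * B.map Complex.ofReal + D.map Complex.ofReal

/-- The `H∞` norm `sup_{ω ∈ ℝ} ‖G(iω)‖₂`. It is meaningful when the system behind `G` is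
asymptotically stable (then the supremum is finite); this is always required separately. -/
def hinfNorm {π μ : Type*} [Fintype π] [Fintype μ] [DecidableEq μ]
    (G : ℂ → Matrix π μ ℂ) : ℝ :=
  ⨆ ω : ℝ, ‖G (Complex.I * (ω : ℂ))‖

/-- The block `X_{ij}` of a block-partitioned matrix. -/
def block {a b : ℕ} {r : Fin a → ℕ} {c : Fin b → ℕ}
    (X : Matrix (Σ i, Fin (r i)) (Σ j, Fin (c j)) ℝ) (i : Fin a) (j : Fin b) :
    Matrix (Fin (r i)) (Fin (c j)) ℝ :=
  Matrix.of fun x y => X ⟨i, x⟩ ⟨j, y⟩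

/-- The nonnegative matrix with entries `‖X_{ij}‖₂`. -/
def blockNorms {a b : ℕ} {r : Fin a → ℕ} {c : Fin b → ℕ}
    (X : Matrix (Σ i, Fin (r i)) (Σ j, Fin (c j)) ℝ) : Matrix (Fin a) (Fin b) ℝ :=
  Matrix.of fun i j => ‖block X i j‖

/-- The logarithmic norm `μ₂(X)`: the largest eigenvalue of `(X + Xᵀ) / 2`. -/
def mu2 {ι : Type*} [Fintype ι] [DecidableEq ι] (X : Matrix ι ι ℝ) : ℝ :=
  sSup (spectrum ℝ ((1 / 2 : ℝ) • (X + Xᵀ)))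

/-- The comparison matrix `M̃^α(A)`. -/
def comparisonM {n : ℕ} {k : Fin n → ℕ}
    (A : Matrix (Σ i, Fin (k i)) (Σ i, Fin (k i)) ℝ) : Matrix (Fin n) (Fin n) ℝ :=
  Matrix.of fun i j =>
    if i = j then -(hinfNorm (resolventFun (block A i i)))⁻¹ else ‖block A i j‖

/-- The comparison matrix `N^α(A)`. -/
def comparisonN {n : ℕ} {k : Fin n → ℕ}
    (A : Matrix (Σ i, Fin (k i)) (Σ i, Fin (k i)) ℝ) : Matrix (Fin n) (Fin n) ℝ :=
  Matrix.of fun i j => if i = j then min (mu2 (block A i i)) 0 else ‖block A i j‖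

/-- The left-hand side of the `H∞` Riccati inequality. -/
def riccati {ι μ π : Type*} [Fintype ι] [Fintype μ] [DecidableEq μ] [Fintype π]
    (A : Matrix ι ι ℝ) (B : Matrix ι μ ℝ) (C : Matrix π ι ℝ) (D : Matrix π μ ℝ)
    (δ : ℝ) (P : Matrix ι ι ℝ) : Matrix ι ι ℝ :=
  P * A + Aᵀ * P + Cᵀ * C
    - (P * B + Cᵀ * D) * (Dᵀ * D - δ ^ 2 • (1 : Matrix μ μ ℝ))⁻¹ * (Dᵀ * C + Bᵀ * P)

open Classical in
/-- Solvability of the block-wise matrix inequalities. The index sets of nonzero blocks are written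
as filters; the matrices that get inverted are required to be positive definite, so that every
inverse is a genuine one. -/
def BlockwiseSolvable {n n₁ n₂ : ℕ} {k : Fin n → ℕ} {m : Fin n₁ → ℕ} {p : Fin n₂ → ℕ}
    (A : Matrix (Σ i, Fin (k i)) (Σ i, Fin (k i)) ℝ)
    (B : Matrix (Σ i, Fin (k i)) (Σ l, Fin (m l)) ℝ)
    (C : Matrix (Σ q, Fin (p q)) (Σ i, Fin (k i)) ℝ)
    (D : Matrix (Σ q, Fin (p q)) (Σ l, Fin (m l)) ℝ) (δ : ℝ) : Prop :=
  ∃ (P : ∀ i : Fin n, Matrix (Fin (k i)) (Fin (k i)) ℝ)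
    (Ξ : ∀ (q : Fin n₂) (_ : Fin n), Matrix (Fin (p q)) (Fin (p q)) ℝ)
    (Γ : ∀ (_ : Fin n) (l : Fin n₁), Matrix (Fin (m l)) (Fin (m l)) ℝ)
    (Φ : ∀ (_ j : Fin n), Matrix (Fin (k j)) (Fin (k j)) ℝ)
    (Υ : ∀ (_ : Fin n₂) (l : Fin n₁), Matrix (Fin (m l)) (Fin (m l)) ℝ)
    (Λ : ∀ (q : Fin n₂) (_ : Fin n₁), Matrix (Fin (p q)) (Fin (p q)) ℝ),
    (∀ i, (P i).PosDef) ∧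
    (∀ q i, (Ξ q i).PosSemidef) ∧ (∀ i l, (Γ i l).PosSemidef) ∧
    (∀ i j, (Φ i j).PosSemidef) ∧
    (∀ q l, (Υ q l).PosSemidef) ∧ (∀ q l, (Λ q l).PosSemidef) ∧
    (∀ q i, ‖block C q i‖ ≠ 0 → (Ξ q i).PosDef) ∧
    (∀ i l, ‖block B i l‖ ≠ 0 → (Γ i l).PosDef) ∧
    (∀ i j, ‖block A i j‖ ≠ 0 → j ≠ i → (Φ i j).PosDef) ∧
    (∀ i, (-(P i * block A i i + (block A i i)ᵀ * P i
        + ∑ j with j ≠ i, Φ j i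
        + ∑ q with ‖block C q i‖ ≠ 0, (block C q i)ᵀ * (Ξ q i)⁻¹ * block C q i
        + P i * (∑ j with ‖block A i j‖ ≠ 0 ∧ j ≠ i,
                    block A i j * (Φ i j)⁻¹ * (block A i j)ᵀ
                  + ∑ l with ‖block B i l‖ ≠ 0,
                    block B i l * (Γ i l)⁻¹ * (block B i l)ᵀ) * P i)).PosDef) ∧
    (∀ q l, (Matrix.fromBlocks (Υ q l) (-(block D q l)ᵀ) (-block D q l) (Λ q l)).PosSemidef) ∧
    (∀ q, (1 - (∑ i, Ξ q i + ∑ l, Λ q l)).PosSemidef) ∧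
    (∀ l, (δ ^ 2 • 1 - (∑ i, Γ i l + ∑ q, Υ q l)).PosDef)

end BlockRiccati


end

open BlockRiccati

/-! The comparison system `(F, G, H, J)` is positive: `F` is Metzler and `G`, `H`, `J` are entrywise
nonnegative. Only its static gain matters: `‖H (-F)⁻¹ G + J‖ < δ` yields positive vectors with `F x
+ G u < 0`, `H x + J u ≤ w`, `Fᵀ z + Hᵀ w < 0` and `Gᵀ z + Jᵀ w < δ² u`
(`exists_positive_certificate`).

The diagonal entries of `F` measure the damping of the blocks: for every `0 < c < -F i i` there is
`Q ≻ 0` with `Q Aᵢᵢ + Aᵢᵢᵀ Q + c (1 + Q²) ≺ 0` (`exists_block_solution`). For the logarithmic norm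
`Q = 1` works. For the resolvent norm this is a strict bounded real lemma, proved by duality: if the
linear matrix inequality fails, a separating functional gives `X`, `U` with `A X Xᵀ + U Xᵀ` skew;
these decompose into pairs satisfying `A x + u = iω x`, and the resolvent bound contradicts the
separation (`trace_le_of_skew`, `exists_riccati_of_resolvent_bound`). Positivity of `Q` is a
Lyapunov argument.

Put `Pᵢ = (zᵢ / xᵢ) Qᵢ` and estimate every coupling block by Young's inequality with weights taken
from `x`, `z`, `u`, `w`. The costs add up to the four vector inequalities (`exists_certificate`).
The same certificate gives (1), with multipliers that are multiples of the identity, and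
dissipativity with storage `Xᵀ P X`, from which every claim of (2) follows. -/

namespace BlockRiccati

open Matrix Filter Topology

/-! ### Euclidean norms of real and complex vectors -/

section Vectors
variable {n : Type*} [Fintype n]

theorem norm_toLp_sq {𝕜 : Type*} [RCLike 𝕜] (v : n → 𝕜) : ‖WithLp.toLp 2 v‖ ^ 2 = ∑ i, ‖v i‖ ^ 2 :=
  EuclideanSpace.norm_sq_eq _

theorem norm_toLp_sq_real (v : n → ℝ) : ‖WithLp.toLp 2 v‖ ^ 2 = v ⬝ᵥ v := by
  rw [norm_toLp_sq]; simp [dotProduct, sq]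

theorem norm_toLp_sq_complex (v : n → ℂ) :
    ‖WithLp.toLp 2 v‖ ^ 2 = (fun i => (v i).re) ⬝ᵥ (fun i => (v i).re)
      + (fun i => (v i).im) ⬝ᵥ (fun i => (v i).im) := by
  rw [norm_toLp_sq]
  simp [dotProduct, ← Finset.sum_add_distrib, Complex.sq_norm, Complex.normSq_apply]

theorem norm_toLp_ofReal (v : n → ℝ) :
    ‖WithLp.toLp 2 (fun i => (v i : ℂ))‖ = ‖WithLp.toLp 2 v‖ := by
  simp [EuclideanSpace.norm_eq]

theorem map_ofReal_mulVec {m : Type*} (M : Matrix m n ℝ) (v : n → ℝ) :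
    M.map Complex.ofReal *ᵥ (fun i => (v i : ℂ)) = fun i => ((M *ᵥ v) i : ℂ) := by
  ext i; simp [mulVec, dotProduct]

theorem re_map_ofReal_mulVec {m : Type*} (M : Matrix m n ℝ) (v : n → ℂ) :
    (fun i => ((M.map Complex.ofReal *ᵥ v) i).re) = M *ᵥ fun i => (v i).re := by
  ext i; simp [mulVec, dotProduct]

theorem im_map_ofReal_mulVec {m : Type*} (M : Matrix m n ℝ) (v : n → ℂ) :
    (fun i => ((M.map Complex.ofReal *ᵥ v) i).im) = M *ᵥ fun i => (v i).im := by
  ext i; simp [mulVec, dotProduct]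

end Vectors

/-! ### The spectral norm and Young's inequality -/

section Norms
variable {𝕜 : Type*} [RCLike 𝕜] {m n : Type*} [Fintype m] [Fintype n] [DecidableEq n]

theorem norm_toLp_mulVec_le (M : Matrix m n 𝕜) (v : n → 𝕜) :
    ‖WithLp.toLp 2 (M *ᵥ v)‖ ≤ ‖M‖ * ‖WithLp.toLp 2 v‖ :=
  M.l2_opNorm_mulVec (WithLp.toLp 2 v)

theorem l2_opNorm_le_of_mulVec (M : Matrix m n 𝕜) {c : ℝ} (hc : 0 ≤ c)
    (h : ∀ v : n → 𝕜, ‖WithLp.toLp 2 (M *ᵥ v)‖ ≤ c * ‖WithLp.toLp 2 v‖) : ‖M‖ ≤ c := by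
  rw [l2_opNorm_def]
  exact ContinuousLinearMap.opNorm_le_bound _ hc fun v => h v.ofLp

theorem mulVec_dotProduct_self_le (M : Matrix m n ℝ) (v : n → ℝ) :
    (M *ᵥ v) ⬝ᵥ (M *ᵥ v) ≤ ‖M‖ ^ 2 * (v ⬝ᵥ v) := by
  classical
  rw [← norm_toLp_sq_real, ← norm_toLp_sq_real, ← mul_pow]
  exact pow_le_pow_left₀ (norm_nonneg _) (norm_toLp_mulVec_le M v) 2

theorem l2_opNorm_le_of_dotProduct (M : Matrix m n ℝ) {c : ℝ} (hc : 0 ≤ c)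
    (h : ∀ v : n → ℝ, (M *ᵥ v) ⬝ᵥ (M *ᵥ v) ≤ c ^ 2 * (v ⬝ᵥ v)) : ‖M‖ ≤ c := by
  classical
  refine l2_opNorm_le_of_mulVec M hc fun v => ?_
  refine le_of_sq_le_sq ?_ (by positivity) 
  rw [mul_pow, norm_toLp_sq_real, norm_toLp_sq_real]
  exact h v

theorem l2_opNorm_transpose [DecidableEq m] (M : Matrix m n ℝ) : ‖Mᵀ‖ = ‖M‖ := by
  simpa using l2_opNorm_conjTranspose M

theorem two_mul_dotProduct_mulVec_le (M : Matrix m n ℝ) (p : m → ℝ) (y : n → ℝ) {α : ℝ}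
    (hα : 0 < α) :
    2 * (p ⬝ᵥ M *ᵥ y) ≤ ‖M‖ * (α * (p ⬝ᵥ p) + α⁻¹ * (y ⬝ᵥ y)) := by
  classical
  have h1 : p ⬝ᵥ M *ᵥ y ≤ ‖WithLp.toLp 2 p‖ * (‖M‖ * ‖WithLp.toLp 2 y‖) := by
    refine le_trans ?_ (mul_le_mul_of_nonneg_left (norm_toLp_mulVec_le M y) (norm_nonneg _))
    have := real_inner_le_norm (WithLp.toLp 2 (M *ᵥ y)) (WithLp.toLp 2 p)
    rw [EuclideanSpace.inner_toLp_toLp] at this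
    simp at this
    linarith
  rw [← norm_toLp_sq_real, ← norm_toLp_sq_real]
  set a := ‖WithLp.toLp 2 p‖
  set b := ‖WithLp.toLp 2 y‖
  have h2 : 2 * (a * b) ≤ α * a ^ 2 + α⁻¹ * b ^ 2 := by
    have h3 : 0 ≤ α * (a - α⁻¹ * b) ^ 2 := by positivity
    have h4 : α * (a - α⁻¹ * b) ^ 2 = α * a ^ 2 + α⁻¹ * b ^ 2 - 2 * (a * b) := by
      field_simp; ring
    linarith
  nlinarith [mul_le_mul_of_nonneg_left h2 (norm_nonneg M)]

theorem l2_opNorm_le_map_ofReal (M : Matrix m n ℝ) : ‖M‖ ≤ ‖M.map Complex.ofReal‖ := by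
  classical
  refine l2_opNorm_le_of_mulVec M (norm_nonneg _) fun v => ?_
  have h := norm_toLp_mulVec_le (M.map Complex.ofReal) (fun i => (v i : ℂ))
  rw [map_ofReal_mulVec] at h
  rwa [norm_toLp_ofReal, norm_toLp_ofReal] at h

end Norms

/-! ### Definiteness through quadratic forms -/

section Forms
variable {n : Type*} [Fintype n]

theorem posDef_of_forms {M : Matrix n n ℝ} (hM : Mᵀ = M)
    (h : ∀ v : n → ℝ, v ≠ 0 → 0 < v ⬝ᵥ M *ᵥ v) : M.PosDef :=
  PosDef.of_dotProduct_mulVec_pos (by simpa [IsHermitian] using hM)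
    fun v hv => by simpa using h v hv

theorem posSemidef_of_forms {M : Matrix n n ℝ} (hM : Mᵀ = M)
    (h : ∀ v : n → ℝ, 0 ≤ v ⬝ᵥ M *ᵥ v) : M.PosSemidef :=
  PosSemidef.of_dotProduct_mulVec_nonneg (by simpa [IsHermitian] using hM)
    fun v => by simpa using h v

theorem dotProduct_self_pos {v : n → ℝ} (hv : v ≠ 0) : 0 < v ⬝ᵥ v := by
  have := dotProduct_star_self_pos_iff.2 hv
  simpa using this

theorem dotProduct_self_nonneg' (v : n → ℝ) : 0 ≤ v ⬝ᵥ v := by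
  have := dotProduct_star_self_nonneg v
  simpa using this

theorem _root_.Matrix.PosDef.transpose_eq {n : Type*} {M : Matrix n n ℝ} (h : M.PosDef) : Mᵀ = M := by
  simpa [IsHermitian] using h.isHermitian

theorem _root_.Matrix.PosDef.form_pos {M : Matrix n n ℝ} (h : M.PosDef) {v : n → ℝ} (hv : v ≠ 0) :
    0 < v ⬝ᵥ M *ᵥ v := by
  simpa using h.dotProduct_mulVec_pos hv

theorem dotProduct_mulVec_eq_transpose {m : Type*} [Fintype m] (M : Matrix m n ℝ) (u : m → ℝ)
    (v : n → ℝ) : u ⬝ᵥ M *ᵥ v = (Mᵀ *ᵥ u) ⬝ᵥ v := by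
  rw [dotProduct_mulVec, mulVec_transpose]

/-- By homogeneity negativity need only be tested on the unit sphere, whose compactness makes the
condition open. -/
theorem isOpen_negative_forms : IsOpen {M : Matrix n n ℝ | ∀ v : n → ℝ, v ≠ 0 → v ⬝ᵥ M *ᵥ v < 0} := by
  have hK : IsCompact (Metric.sphere (0 : n → ℝ) 1) := isCompact_sphere _ _
  have e : {M : Matrix n n ℝ | ∀ v : n → ℝ, v ≠ 0 → v ⬝ᵥ M *ᵥ v < 0}
      = {M | ∀ v ∈ Metric.sphere (0 : n → ℝ) 1, v ⬝ᵥ M *ᵥ v < 0} := by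
    ext M
    refine ⟨fun h v hv => h v ?_, fun h v hv => ?_⟩
    · rintro rfl; simp at hv
    · have h1 := h (‖v‖⁻¹ • v) (by
        simp [norm_smul, inv_mul_cancel₀ (norm_ne_zero_iff.2 hv)])
      rw [mulVec_smul, dotProduct_smul, smul_dotProduct, smul_eq_mul, smul_eq_mul,
        ← mul_assoc] at h1
      have h2 : 0 < ‖v‖⁻¹ * ‖v‖⁻¹ := by have := norm_pos_iff.2 hv; positivity
      exact neg_of_mul_neg_right h1 h2.le
  rw [e, isOpen_iff_mem_nhds]
  intro M hM
  refine hK.eventually_forall_of_forall_eventually fun v hv => ?_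
  have hc : Continuous fun q : (Matrix n n ℝ) × (n → ℝ) => q.2 ⬝ᵥ q.1 *ᵥ q.2 :=
    continuous_snd.dotProduct (continuous_fst.matrix_mulVec continuous_snd)
  exact hc.continuousAt.eventually_lt continuousAt_const (hM v hv)

end Forms

/-! ### Duality for linear matrix inequalities -/

section Separation
variable {κ : Type*} [Fintype κ] [DecidableEq κ]

theorem dotProduct_mulVec_eq_trace {κ : Type*} [Fintype κ] (M : Matrix κ κ ℝ) (v : κ → ℝ) :
    v ⬝ᵥ M *ᵥ v = (M * vecMulVec v v).trace := by
  rw [mul_vecMulVec, trace_vecMulVec, dotProduct_comm]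

theorem exists_trace_repr (f : Matrix κ κ ℝ →ₗ[ℝ] ℝ) :
    ∃ Z : Matrix κ κ ℝ, ∀ M, f M = (Z * M).trace := by
  refine ⟨of fun i j => f (single j i 1), fun M => ?_⟩
  conv_lhs => rw [matrix_eq_sum_single M]
  simp only [map_sum, trace, diag_apply, mul_apply, of_apply]
  rw [Finset.sum_comm]
  refine Finset.sum_congr rfl fun i _ => Finset.sum_congr rfl fun j _ => ?_
  have : single j i (M j i) = M j i • single j i (1 : ℝ) := by simp
  rw [this, map_smul, smul_eq_mul, mul_comm]

/-- Theorem of alternatives for linear matrix inequalities. -/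
theorem exists_negative_or_dual {E : Type*} [AddCommGroup E] [Module ℝ E]
    (M₀ : Matrix κ κ ℝ) (hM₀ : M₀ᵀ = M₀) (L : E →ₗ[ℝ] Matrix κ κ ℝ) (hL : ∀ q, (L q)ᵀ = L q) :
    (∃ q, ∀ v : κ → ℝ, v ≠ 0 → v ⬝ᵥ (M₀ + L q) *ᵥ v < 0) ∨
    ∃ Z : Matrix κ κ ℝ, Z.PosSemidef ∧ Z.trace ≠ 0 ∧ (∀ q, (Z * L q).trace = 0) ∧
      0 ≤ (Z * M₀).trace := by
  refine or_iff_not_imp_left.2 fun hno => ?_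
  set O : Set (Matrix κ κ ℝ) := {M | ∀ v : κ → ℝ, v ≠ 0 → v ⬝ᵥ M *ᵥ v < 0}
  have hconv : Convex ℝ O := by
    intro M hM N hN a b ha hb hab v hv
    have h1 := hM v hv
    have h2 := hN v hv
    simp only [add_mulVec, smul_mulVec, dotProduct_add, dotProduct_smul, smul_eq_mul]
    rcases ha.eq_or_lt with rfl | ha
    · have : b = 1 := by linarith
      subst this; linarith
    · nlinarith
  have hS : Convex ℝ (Set.range fun q => M₀ + L q) := by
    rintro _ ⟨p, rfl⟩ _ ⟨q, rfl⟩ a b ha hb hab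
    refine ⟨a • p + b • q, ?_⟩
    simp only [map_add, map_smul, smul_add]
    have : M₀ = a • M₀ + b • M₀ := by rw [← add_smul, hab, one_smul]
    nth_rewrite 1 [this]
    abel
  have hdisj : Disjoint O (Set.range fun q => M₀ + L q) := by
    rw [Set.disjoint_right]
    rintro _ ⟨q, rfl⟩ hq
    exact hno ⟨q, hq⟩
  -- If no `q` works, the open convex cone of negative forms misses the affine range. Since `O` is a
  -- cone, the separating level `u` is nonnegative and `f ≤ 0` on `O`.
  obtain ⟨f, u, hfO, hfS⟩ := geometric_hahn_banach_open hconv isOpen_negative_forms hS hdisj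
  have hsmul : ∀ a ∈ O, ∀ t : ℝ, 0 < t → t • a ∈ O := by
    intro a ha t ht v hv
    simp only [smul_mulVec, dotProduct_smul, smul_eq_mul]
    exact mul_neg_of_pos_of_neg ht (ha v hv)
  have hlt : ∀ a ∈ O, ∀ t : ℝ, 0 < t → t * f a < u := by
    intro a ha t ht
    simpa using hfO _ (hsmul a ha t ht)
  have hneg : ∀ a ∈ O, f a ≤ 0 := by
    intro a ha
    by_contra! h
    have h1 := hlt a ha ((|u| + 1) / f a) (by positivity)
    rw [div_mul_cancel₀ _ h.ne'] at h1
    linarith [le_abs_self u]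
  have h1O : (-1 : Matrix κ κ ℝ) ∈ O := by
    intro v hv
    simpa [neg_mulVec] using dotProduct_self_pos hv
  have hu : 0 ≤ u := by
    by_contra! h
    have h1 := hlt _ h1O 1 one_pos
    have h2 : f (-1) < 0 := by linarith
    have h3 := hlt _ h1O (u / (2 * f (-1))) (div_pos_of_neg_of_neg h (by linarith))
    have : u / (2 * f (-1)) * f (-1) = u / 2 := by
      have := h2.ne
      field_simp
    linarith
  have hb : ∀ q, u ≤ f M₀ + f (L q) := fun q => by
    simpa using hfS _ ⟨q, rfl⟩
  obtain ⟨Z, hZ⟩ := exists_trace_repr (f : Matrix κ κ ℝ →ₗ[ℝ] ℝ)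
  have hZ' : ∀ M, f M = (Z * M).trace := hZ
  have hsym : ∀ M : Matrix κ κ ℝ, Mᵀ = M → (((1 / 2 : ℝ) • (Z + Zᵀ)) * M).trace = f M := by
    intro M hM
    have : (Zᵀ * M).trace = (Z * M).trace := by
      rw [← trace_transpose, transpose_mul, transpose_transpose, hM, trace_mul_comm]
    rw [smul_mul, add_mul, trace_smul, trace_add, this, hZ', smul_eq_mul]; ring
  have hf1 : f (-1) < u := hfO _ h1O
  -- Only symmetric matrices are tested, so `Z` may be symmetrised. Evaluating `f` on `-v vᵀ - η 1`,
  -- which lies in `O`, and letting `η` shrink gives `vᵀ Z v ≥ 0`.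
  have hpsd : ((1 / 2 : ℝ) • (Z + Zᵀ)).PosSemidef := by
    refine posSemidef_of_forms (by simp [add_comm]) fun v => ?_
    rw [dotProduct_mulVec_eq_trace, hsym _ (by simp [transpose_vecMulVec])]
    refine le_of_forall_pos_le_add fun ε hε => ?_
    set η := ε / (|f 1| + 1)
    have hη : 0 < η := by positivity
    have h1 : -vecMulVec v v - η • (1 : Matrix κ κ ℝ) ∈ O := by
      intro w hw
      have h2 := mul_pos hη (dotProduct_self_pos hw)
      simp only [sub_mulVec, neg_mulVec, smul_mulVec, one_mulVec, dotProduct_sub, dotProduct_neg,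
        dotProduct_smul, smul_eq_mul, vecMulVec_mulVec, op_smul_eq_smul]
      rw [dotProduct_comm w v]
      nlinarith [sq_nonneg (v ⬝ᵥ w)]
    have h2 := hneg _ h1
    simp only [map_sub, map_neg, map_smul, smul_eq_mul] at h2
    have h3 : η * |f 1| ≤ ε := by
      rw [div_mul_eq_mul_div, div_le_iff₀ (by positivity)]
      nlinarith
    nlinarith [le_abs_self (f 1)]
  refine ⟨(1 / 2 : ℝ) • (Z + Zᵀ), hpsd, ?_, fun q => ?_, ?_⟩
  · intro h0
    have h2 : ∀ M : Matrix κ κ ℝ, Mᵀ = M → f M = 0 := by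
      intro M hM
      rw [← hsym M hM, hpsd.trace_eq_zero_iff.1 h0, Matrix.zero_mul, trace_zero]
    have h3 := hb 0
    rw [map_zero, map_zero, h2 _ hM₀] at h3
    rw [h2 _ (by simp)] at hf1
    linarith
  · rw [hsym _ (hL q)]
    -- A linear functional bounded below on a subspace vanishes there; this multiple of `q` would
    -- give `f (M₀ + L q) = -1 < u`.
    by_contra h
    have h1 := hb ((-(f M₀ + 1) / f (L q)) • q)
    rw [map_smul, map_smul, smul_eq_mul, div_mul_cancel₀ _ h] at h1
    linarith
  · rw [hsym _ hM₀]
    have := hb 0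
    simp at this
    linarith

end Separation

/-! ### Spectral square roots -/

section SquareRoot
variable {ι : Type*} [Fintype ι] [DecidableEq ι]

theorem exists_orthogonal_diagonalization {S : Matrix ι ι ℝ} (hS : S.IsHermitian) :
    ∃ V : Matrix ι ι ℝ, Vᵀ * V = 1 ∧ V * Vᵀ = 1 ∧ S = V * diagonal hS.eigenvalues * Vᵀ := by
  refine ⟨hS.eigenvectorUnitary, ?_, ?_, ?_⟩
  · simpa [star_eq_conjTranspose] using Unitary.coe_star_mul_self hS.eigenvectorUnitary
  · simpa [star_eq_conjTranspose] using Unitary.coe_mul_star_self hS.eigenvectorUnitary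
  · have := hS.spectral_theorem
    rw [Unitary.conjStarAlgAut_apply] at this
    simpa [star_eq_conjTranspose, Function.comp_def] using this

/-- A positive semidefinite real matrix has a square root with a commuting pseudo-inverse. -/
theorem exists_sqrt_pinv (G : Matrix ι ι ℝ) (hG : G.PosSemidef) :
    ∃ S R : Matrix ι ι ℝ, Sᵀ = S ∧ Rᵀ = R ∧ S * S = G ∧ S * R * S = S ∧ R * S * R = R ∧
      S * R = R * S := by
  obtain ⟨V, hV, -, hs⟩ := exists_orthogonal_diagonalization hG.isHermitian
  have hd : ∀ i, 0 ≤ hG.isHermitian.eigenvalues i := hG.eigenvalues_nonneg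
  set d : ι → ℝ := hG.isHermitian.eigenvalues
  have hmul : ∀ a b : ι → ℝ, (V * diagonal a * Vᵀ) * (V * diagonal b * Vᵀ)
      = V * diagonal (fun i => a i * b i) * Vᵀ := by
    intro a b
    rw [← diagonal_mul_diagonal]
    calc _ = V * diagonal a * (Vᵀ * V) * diagonal b * Vᵀ := by simp only [Matrix.mul_assoc]
      _ = _ := by rw [hV]; simp only [Matrix.mul_assoc, Matrix.mul_one]
  have ht : ∀ a : ι → ℝ, (V * diagonal a * Vᵀ)ᵀ = V * diagonal a * Vᵀ := by
    intro a; simp [Matrix.mul_assoc]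
  refine ⟨V * diagonal (fun i => √(d i)) * Vᵀ, V * diagonal (fun i => (√(d i))⁻¹) * Vᵀ,
    ht _, ht _, ?_, ?_, ?_, ?_⟩
  · rw [hmul]; conv_rhs => rw [hs]
    simp [Real.mul_self_sqrt (hd _)]
  · rw [hmul, hmul]; simp [mul_inv_mul_cancel]
  · rw [hmul, hmul]; congr 3; ext i
    simpa using mul_inv_mul_cancel (√(d i))⁻¹
  · rw [hmul, hmul]; simp [mul_comm]

end SquareRoot

/-! ### The bounded real lemma for a resolvent -/

section Resolvent
variable {ι κ : Type*} [Fintype ι] [DecidableEq ι] [Fintype κ]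

theorem sum_norm_col_sq {m n : Type*} [Fintype m] [Fintype n] (N : Matrix m n ℂ) :
    ∑ k, ‖WithLp.toLp 2 (fun i => N i k)‖ ^ 2 = (N * Nᴴ).trace.re := by
  simp only [norm_toLp_sq, trace, diag_apply, mul_apply, conjTranspose_apply, Complex.re_sum]
  rw [Finset.sum_comm]
  refine Finset.sum_congr rfl fun i _ => Finset.sum_congr rfl fun j _ => ?_
  simp [Complex.sq_norm, Complex.normSq_apply]

theorem sum_norm_mul_unitary {m : Type*} [Fintype m] (M : Matrix m ι ℝ)
    (W : Matrix.unitaryGroup ι ℂ) :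
    ∑ k, ‖WithLp.toLp 2 (M.map Complex.ofReal *ᵥ fun i => (W : Matrix ι ι ℂ) i k)‖ ^ 2
      = (M * Mᵀ).trace := by
  have h := sum_norm_col_sq (M.map Complex.ofReal * (W : Matrix ι ι ℂ))
  have hW : (W : Matrix ι ι ℂ) * (W : Matrix ι ι ℂ)ᴴ = 1 := by
    simpa [star_eq_conjTranspose] using Unitary.coe_mul_star_self W
  have e : M.map Complex.ofReal * (W : Matrix ι ι ℂ) * (M.map Complex.ofReal * (W : Matrix ι ι ℂ))ᴴ
      = (M * Mᵀ).map Complex.ofReal := by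
    rw [conjTranspose_mul]
    calc _ = M.map Complex.ofReal * ((W : Matrix ι ι ℂ) * (W : Matrix ι ι ℂ)ᴴ)
          * (M.map Complex.ofReal)ᴴ := by simp only [Matrix.mul_assoc]
      _ = _ := by
        rw [hW, Matrix.mul_one]
        ext i j
        simp [mul_apply]
  rw [e] at h
  have t : ((M * Mᵀ).map Complex.ofReal).trace.re = (M * Mᵀ).trace := by
    simp [trace]
  rw [t] at h
  exact h

/-- If `A X Xᵀ + U Xᵀ` is skew-symmetric, then `X` and `U` decompose into pairs `(x, u)` with
`A x + u = i ω x`, so that a bound on the resolvent along the imaginary axis compares traces. -/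
theorem trace_le_of_skew (A : Matrix ι ι ℝ) (X U : Matrix ι κ ℝ) {g : ℝ}
    (hres : ∀ (ω : ℝ) (x u : ι → ℂ),
      A.map Complex.ofReal *ᵥ x + u = (Complex.I * (ω : ℂ)) • x →
      ‖WithLp.toLp 2 x‖ ^ 2 ≤ g ^ 2 * ‖WithLp.toLp 2 u‖ ^ 2)
    (h : A * (X * Xᵀ) + U * Xᵀ + (A * (X * Xᵀ) + U * Xᵀ)ᵀ = 0) :
    (X * Xᵀ).trace ≤ g ^ 2 * (U * Uᵀ).trace := by
  have hG : (X * Xᵀ).PosSemidef := by simpa using posSemidef_self_mul_conjTranspose X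
  obtain ⟨S, R, hS, hR, hSS, hSRS, hRSR, hSR⟩ := exists_sqrt_pinv _ hG
  -- `S R` is the orthogonal projection onto the range of `X`.
  have hX : Xᵀ * (S * R) = Xᵀ := by
    have h1 : (X - S * R * X) * (X - S * R * X)ᵀ = 0 := by
      have e : S * R * (X * Xᵀ) = X * Xᵀ := by
        rw [← hSS, ← Matrix.mul_assoc, hSRS]
      have hE : (S * R)ᵀ = S * R := by rw [transpose_mul, hR, hS, hSR]
      have e2 : X * Xᵀ * (S * R) = X * Xᵀ := by
        have := congrArg transpose e
        simpa only [transpose_mul, transpose_transpose, hE, hS, hR, ← hSR] using this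
      rw [transpose_sub, transpose_mul, hE, Matrix.sub_mul, Matrix.mul_sub, Matrix.mul_sub,
        ← Matrix.mul_assoc X, e2, ← Matrix.mul_assoc (S * R * X), Matrix.mul_assoc (S * R) X, e, e2]
      simp
    have h2 : X - S * R * X = 0 := by
      rw [← conjTranspose_eq_transpose_of_trivial] at h1
      exact self_mul_conjTranspose_eq_zero.1 h1
    have h3 := congrArg transpose (sub_eq_zero.1 h2)
    rw [transpose_mul, transpose_mul, hR, hS, ← hSR] at h3
    exact h3.symm
  -- `S` replaces `X` and `U Xᵀ R` replaces `U`. The hypothesis makes `V S` skew, hence `V = S K`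
  -- with `K = R V` skew. An eigenvector `w` of `K` with eigenvalue `iω` then gives `A (S w) + (U Xᵀ
  -- R) w = iω (S w)`, to which the resolvent bound applies; summing over a unitary eigenbasis
  -- produces traces.
  set V := A * S + U * Xᵀ * R with hVdef
  have hVS : V * S + S * Vᵀ = 0 := by
    have e : V * S = A * (X * Xᵀ) + U * Xᵀ := by
      rw [hVdef, Matrix.add_mul, Matrix.mul_assoc, hSS, Matrix.mul_assoc, Matrix.mul_assoc U,
        ← hSR, hX]
    rw [← e, transpose_mul, hS] at h
    exact h
  have hVE : V * (S * R) = V := by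
    rw [hVdef, Matrix.add_mul]
    congr 1
    · rw [Matrix.mul_assoc, hSR, ← Matrix.mul_assoc S, hSRS]
    · rw [Matrix.mul_assoc, ← Matrix.mul_assoc R, hRSR]
  have hV' : V = -(S * Vᵀ * R) := by
    have e := congrArg (· * R) (eq_neg_of_add_eq_zero_left hVS)
    simp only [Matrix.mul_assoc, hVE, Matrix.neg_mul] at e
    rw [Matrix.mul_assoc]; exact e
  set K := R * V with hK
  have hSK : S * K = V := by
    rw [hK, hV', ← Matrix.mul_assoc, Matrix.mul_neg, ← Matrix.mul_assoc, ← Matrix.mul_assoc, hSRS]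
  have hKt : Kᵀ = -K := by
    have e : Vᵀ = R * S * Vᵀ := by
      have := congrArg transpose hVE
      rw [transpose_mul, transpose_mul, hR, hS] at this
      exact this.symm
    rw [hK, transpose_mul, hR, e]
    conv_rhs => rw [hV']
    simp only [Matrix.mul_assoc, Matrix.mul_neg, neg_neg]
  have hT : (Complex.I • K.map Complex.ofReal).IsHermitian := by
    ext i j
    have e : K j i = -K i j := by
      have := congrFun (congrFun hKt i) j
      simpa using this
    simp [e]
  set W := hT.eigenvectorUnitary
  have hx := sum_norm_mul_unitary S W
  have hu := sum_norm_mul_unitary (U * Xᵀ * R) W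
  have hW : ∀ k, V.map Complex.ofReal *ᵥ (fun i => (W : Matrix ι ι ℂ) i k)
      = (Complex.I * ((-hT.eigenvalues k : ℝ) : ℂ)) •
        (S.map Complex.ofReal *ᵥ fun i => (W : Matrix ι ι ℂ) i k) := by
    intro k
    have e := hT.mulVec_eigenvectorBasis k
    have e1 : K.map Complex.ofReal *ᵥ (fun i => (W : Matrix ι ι ℂ) i k)
        = (Complex.I * ((-hT.eigenvalues k : ℝ) : ℂ)) • (fun i => (W : Matrix ι ι ℂ) i k) := by
      have e2 := congrArg ((-Complex.I) • ·) e
      simp only [smul_mulVec, smul_smul] at e2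
      simp only [neg_mul, Complex.I_mul_I, neg_neg, one_smul] at e2
      refine e2.trans ?_
      ext i
      simp [W]
      ring
    have e3 : V.map Complex.ofReal = S.map Complex.ofReal * K.map Complex.ofReal := by
      rw [← hSK]; ext i j; simp [mul_apply]
    rw [e3, ← mulVec_mulVec, e1, mulVec_smul]
  have hmain : (S * Sᵀ).trace ≤ g ^ 2 * ((U * Xᵀ * R) * (U * Xᵀ * R)ᵀ).trace := by
    rw [← hx, ← hu, Finset.mul_sum]
    refine Finset.sum_le_sum fun k _ => hres (-hT.eigenvalues k) _ _ ?_
    rw [← hW k, mulVec_mulVec, ← add_mulVec]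
    congr 1
    ext i j
    simp [hVdef, mul_apply]
  have hUU : ((U * Xᵀ * R) * (U * Xᵀ * R)ᵀ).trace ≤ (U * Uᵀ).trace := by
    -- `N` is an orthogonal projection, so replacing `U` by `U N` cannot increase the trace.
    set N := Xᵀ * R * (R * X) with hN
    have hNt : Nᵀ = N := by simp [hN, hR, Matrix.mul_assoc]
    have hNN : N * N = N := by
      calc N * N = Xᵀ * (R * (R * (X * Xᵀ)) * R) * (R * X) := by
            simp only [hN, Matrix.mul_assoc]
        _ = Xᵀ * (R * (R * (S * S)) * R) * (R * X) := by rw [hSS]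
        _ = Xᵀ * (R * (S * R) * (S * R)) * (R * X) := by
            congr 2
            rw [← Matrix.mul_assoc R S S, ← hSR]
            simp only [Matrix.mul_assoc]
        _ = N := by
            rw [← Matrix.mul_assoc R S R, hRSR, ← Matrix.mul_assoc R S R, hRSR]
    have e1 : (U * Xᵀ * R) * (U * Xᵀ * R)ᵀ = U * N * Uᵀ := by
      simp [hN, hR, Matrix.mul_assoc]
    have e2 : (U - U * N) * (U - U * N)ᵀ = U * Uᵀ - U * N * Uᵀ := by
      rw [transpose_sub, transpose_mul, hNt, Matrix.sub_mul, Matrix.mul_sub, Matrix.mul_sub,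
        ← Matrix.mul_assoc (U * N), Matrix.mul_assoc U N N, hNN, ← Matrix.mul_assoc U]
      abel
    have h3 : 0 ≤ ((U - U * N) * (U - U * N)ᵀ).trace := by
      have := (posSemidef_self_mul_conjTranspose (U - U * N)).trace_nonneg
      simpa using this
    rw [e2, trace_sub] at h3
    rw [e1]; linarith
  rw [hS, hSS] at hmain
  exact hmain.trans (mul_le_mul_of_nonneg_left hUU (sq_nonneg g))

theorem trace_fromBlocks {m n : Type*} [Fintype m] [Fintype n] (P : Matrix m m ℝ)
    (Q : Matrix m n ℝ) (R : Matrix n m ℝ) (S : Matrix n n ℝ) :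
    (fromBlocks P Q R S).trace = P.trace + S.trace := by
  simp [trace, Fintype.sum_sum_type]

/-- `X` and `U` are the two row blocks of a symmetric square root of `Z`. -/
theorem exists_dual_factor (Z : Matrix (ι ⊕ ι) (ι ⊕ ι) ℝ) (hZ : Z.PosSemidef) :
    ∃ X U : Matrix ι (ι ⊕ ι) ℝ, Z = fromBlocks (X * Xᵀ) (X * Uᵀ) (U * Xᵀ) (U * Uᵀ) := by
  obtain ⟨Y, -, hY, -, hYY, -⟩ := exists_sqrt_pinv Z hZ
  refine ⟨Y.submatrix Sum.inl id, Y.submatrix Sum.inr id, ?_⟩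
  conv_lhs => rw [← hYY]; enter [2]; rw [← hY]
  ext (i | i) (j | j) <;> simp [mul_apply]

/-- Strict bounded real lemma for a resolvent (without the positivity of `Q`). -/
theorem exists_riccati_of_resolvent_bound (A : Matrix ι ι ℝ) {c g : ℝ} (hc : 0 < c) (hg : 0 ≤ g)
    (hcg : c * g < 1)
    (hres : ∀ (ω : ℝ) (x u : ι → ℂ),
      A.map Complex.ofReal *ᵥ x + u = (Complex.I * (ω : ℂ)) • x →
      ‖WithLp.toLp 2 x‖ ^ 2 ≤ g ^ 2 * ‖WithLp.toLp 2 u‖ ^ 2) :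
    ∃ Q : Matrix ι ι ℝ, Qᵀ = Q ∧ ∀ v : ι → ℝ, v ≠ 0 →
      2 * ((Q *ᵥ v) ⬝ᵥ (A *ᵥ v)) + c * (v ⬝ᵥ v + (Q *ᵥ v) ⬝ᵥ (Q *ᵥ v)) < 0 := by
  -- With `Q = q + qᵀ`, the matrix `M₀ + L q` is the Schur complement form of `Q A + Aᵀ Q + c (1 +
  -- Q²)`. Symmetrising `q` lets `L` be linear on all matrices.
  let M₀ : Matrix (ι ⊕ ι) (ι ⊕ ι) ℝ := fromBlocks (c • 1) 0 0 (-(c⁻¹ • 1))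
  let L : Matrix ι ι ℝ →ₗ[ℝ] Matrix (ι ⊕ ι) (ι ⊕ ι) ℝ :=
    { toFun := fun q => fromBlocks ((q + qᵀ) * A + Aᵀ * (q + qᵀ)) (q + qᵀ) (q + qᵀ) 0
      map_add' := fun p q => by
        rw [fromBlocks_add]
        simp only [transpose_add, Matrix.add_mul, Matrix.mul_add, add_zero]
        congr 1 <;> abel
      map_smul' := fun t q => by
        rw [RingHom.id_apply, fromBlocks_smul]
        simp only [transpose_smul, Matrix.mul_add, Matrix.add_mul, Matrix.smul_mul,
          Matrix.mul_smul, smul_add, smul_zero] }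
  have hM₀ : M₀ᵀ = M₀ := by simp [M₀, fromBlocks_transpose]
  have hL : ∀ q, (L q)ᵀ = L q := by
    intro q
    simp only [L, LinearMap.coe_mk, AddHom.coe_mk, fromBlocks_transpose, transpose_add,
      transpose_mul, transpose_transpose, transpose_zero]
    congr 1 <;> (try simp only [Matrix.mul_add, Matrix.add_mul]) <;> abel
  rcases exists_negative_or_dual M₀ hM₀ L hL with ⟨q, hq⟩ | ⟨Z, hZ, hZ0, hZL, hZM⟩
  · refine ⟨q + qᵀ, by simp [add_comm], fun v hv => ?_⟩
    set Q := q + qᵀ with hQ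
    -- The second component `c Q v` maximises the form for given `v`, which undoes the Schur
    -- complement.
    have h1 := hq (Sum.elim v (c • (Q *ᵥ v))) (fun h => hv (by
      ext i; simpa using congrFun h (Sum.inl i)))
    have h2 : M₀ + L q = fromBlocks (c • 1 + (Q * A + Aᵀ * Q)) Q Q (-(c⁻¹ • 1)) := by
      simp [M₀, L, fromBlocks_add, hQ]
    have hQt : Qᵀ = Q := by simp [hQ, add_comm]
    rw [h2, fromBlocks_mulVec, sumElim_dotProduct_sumElim] at h1
    simp only [Sum.elim_comp_inl, Sum.elim_comp_inr, add_mulVec, smul_mulVec, one_mulVec,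
      neg_mulVec, mulVec_smul, dotProduct_add, dotProduct_smul, smul_dotProduct, smul_eq_mul,
      dotProduct_neg, ← mulVec_mulVec] at h1
    have e1 : v ⬝ᵥ Q *ᵥ A *ᵥ v = (Q *ᵥ v) ⬝ᵥ (A *ᵥ v) := by
      rw [dotProduct_mulVec_eq_transpose, hQt]
    have e2 : v ⬝ᵥ Aᵀ *ᵥ Q *ᵥ v = (Q *ᵥ v) ⬝ᵥ (A *ᵥ v) := by
      rw [dotProduct_mulVec_eq_transpose, transpose_transpose, dotProduct_comm]
    have e3 : v ⬝ᵥ Q *ᵥ Q *ᵥ v = (Q *ᵥ v) ⬝ᵥ (Q *ᵥ v) := by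
      rw [dotProduct_mulVec_eq_transpose, hQt]
    rw [e1, e2, e3, inv_mul_cancel_left₀ hc.ne'] at h1
    linarith
  · exfalso
    obtain ⟨X, U, rfl⟩ := exists_dual_factor Z hZ
    set Y := A * (X * Xᵀ) + U * Xᵀ with hY
    have hYY : Y + Yᵀ = 0 := by
      -- Orthogonality to every `L q` says that `Y + Yᵀ` is trace-orthogonal to all symmetric
      -- matrices; testing with itself makes it zero.
      have e := hZL (Y + Yᵀ)
      simp only [L, LinearMap.coe_mk, AddHom.coe_mk, fromBlocks_multiply, trace_fromBlocks] at e
      set H := Y + Yᵀ with hH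
      have hHt : Hᵀ = H := by simp [hH, add_comm]
      clear_value H
      rw [hHt] at e
      have e1 : ∀ T : Matrix ι ι ℝ, (Yᵀ * T).trace = (Y * Tᵀ).trace := by
        intro T
        rw [← trace_transpose, transpose_mul, transpose_transpose, trace_mul_comm]
      have e2 : (H * Hᵀ).trace = 0 := by
        have hHH : (H + H)ᵀ = H + H := by simp [hHt]
        have f1 : (H * Hᵀ).trace + (H * Hᵀ).trace = ((H + H) * H).trace := by
          rw [hHt, Matrix.add_mul, trace_add]
        have f2 : ((H + H) * H).trace = ((H + H) * Y).trace + ((H + H) * Yᵀ).trace := by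
          rw [← trace_add, ← Matrix.mul_add, ← hH]
        have f3 : ((H + H) * Yᵀ).trace = ((H + H) * Y).trace := by
          rw [trace_mul_comm, e1, hHH, trace_mul_comm]
        have f4 : ((H + H) * Y).trace
            = (X * Xᵀ * ((H + H) * A)).trace + (U * Xᵀ * (H + H)).trace := by
          rw [hY, Matrix.mul_add, trace_add, trace_mul_comm (U * Xᵀ),
            trace_mul_comm (X * Xᵀ), Matrix.mul_assoc]
        have f5 : (X * Xᵀ * (Aᵀ * (H + H))).trace = (X * Xᵀ * ((H + H) * A)).trace := by
          rw [← trace_transpose]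
          simp only [transpose_mul, transpose_transpose, hHH]
          rw [trace_mul_comm]
        have f6 : (X * Uᵀ * (H + H)).trace = (U * Xᵀ * (H + H)).trace := by
          rw [← trace_transpose]
          simp only [transpose_mul, transpose_transpose, hHH]
          rw [trace_mul_comm]
        simp only [Matrix.mul_add (X * Xᵀ) ((H + H) * A), trace_add, f5, f6, Matrix.mul_zero, trace_zero] at e
        linarith
      have := trace_mul_conjTranspose_self_eq_zero_iff (A := H)
      rw [conjTranspose_eq_transpose_of_trivial] at this
      exact this.1 e2
    have h1 := trace_le_of_skew A X U hres hYY
    simp only [M₀, fromBlocks_multiply, trace_fromBlocks] at hZM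
    simp at hZM
    have hX : 0 ≤ (X * Xᵀ).trace := by
      simpa using (posSemidef_self_mul_conjTranspose X).trace_nonneg
    have hU : 0 ≤ (U * Uᵀ).trace := by
      simpa using (posSemidef_self_mul_conjTranspose U).trace_nonneg
    rw [trace_fromBlocks] at hZ0
    set a := (X * Xᵀ).trace
    set b := (U * Uᵀ).trace
    -- Together with `a ≤ g² b` this gives `a ≤ (c g)² a` with `c g < 1`, so `a = b = 0`, against
    -- `Z.trace ≠ 0`.
    have h2 : b ≤ c ^ 2 * a := by
      have : c * (c⁻¹ * b) ≤ c * (c * a) := by gcongr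
      rw [mul_inv_cancel_left₀ hc.ne'] at this
      linarith
    have h3 : (c * g) ^ 2 < 1 := by
      have : 0 ≤ c * g := by positivity
      nlinarith
    have h4 : a ≤ (c * g) ^ 2 * a := by nlinarith [mul_le_mul_of_nonneg_left h2 (sq_nonneg g)]
    have ha : a = 0 := by nlinarith
    rw [ha] at h2
    exact hZ0 (by linarith)

end Resolvent

/-! ### Hurwitz matrices: resolvent bound, Cayley transform, Lyapunov -/

section Hurwitz
variable {ι : Type*} [Fintype ι] [DecidableEq ι]

theorem IsHurwitz.isUnit {A : Matrix ι ι ℝ} (hA : IsHurwitz A) {z : ℂ} (hz : 0 ≤ z.re) :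
    IsUnit (z • (1 : Matrix ι ι ℂ) - A.map Complex.ofReal) := by
  have h : z ∉ spectrum ℂ (A.map Complex.ofReal) := fun h => absurd (hA z h) (not_lt.2 hz)
  rw [spectrum.notMem_iff, Algebra.algebraMap_eq_smul_one] at h
  exact h

theorem IsHurwitz.det_ne_zero {A : Matrix ι ι ℝ} (hA : IsHurwitz A) {s : ℝ} (hs : 0 ≤ s) :
    (s • (1 : Matrix ι ι ℝ) - A).det ≠ 0 := by
  intro h
  obtain ⟨v, hv, hv0⟩ := exists_mulVec_eq_zero_iff.2 h
  have h1 : ((s : ℂ) • (1 : Matrix ι ι ℂ) - A.map Complex.ofReal) *ᵥ (fun i => (v i : ℂ)) = 0 := by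
    rw [sub_mulVec, map_ofReal_mulVec, smul_mulVec, one_mulVec]
    ext i
    have := congrFun hv0 i
    simp only [sub_mulVec, smul_mulVec, one_mulVec, Pi.sub_apply, Pi.smul_apply,
      smul_eq_mul, Pi.zero_apply] at this ⊢
    exact_mod_cast this
  have h2 := mulVec_injective_of_isUnit (hA.isUnit (z := s) (by simpa using hs))
  have h3 := h2 (h1.trans (mulVec_zero _).symm)
  apply hv
  ext i
  simpa using congrFun h3 i

theorem isHurwitz_of_eigenvectors {A : Matrix ι ι ℝ}
    (h : ∀ (z : ℂ) (x : ι → ℂ), x ≠ 0 → A.map Complex.ofReal *ᵥ x = z • x → z.re < 0) :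
    IsHurwitz A := by
  intro z hz
  rw [spectrum.mem_iff, Algebra.algebraMap_eq_smul_one, isUnit_iff_isUnit_det, isUnit_iff_ne_zero,
    not_not] at hz
  obtain ⟨x, hx, hx0⟩ := exists_mulVec_eq_zero_iff.2 hz
  refine h z x hx ?_
  rw [sub_mulVec, smul_mulVec, one_mulVec] at hx0
  exact (sub_eq_zero.1 hx0).symm

/-- The resolvent is continuous on the imaginary axis and vanishes at infinity. Boundedness is what
makes the supremum in `hinfNorm` genuine. -/
theorem IsHurwitz.exists_resolvent_bound {A : Matrix ι ι ℝ} (hA : IsHurwitz A) :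
    ∃ M, ∀ ω : ℝ, ‖resolventFun A (Complex.I * (ω : ℂ))‖ ≤ M := by
  have e : ∀ ω : ℝ, resolventFun A (Complex.I * (ω : ℂ))
      = resolvent (A.map Complex.ofReal) (Complex.I * (ω : ℂ)) := by
    intro ω
    rw [resolvent, resolventFun, nonsing_inv_eq_ringInverse, Algebra.algebraMap_eq_smul_one]
  have hcont : Continuous fun ω : ℝ => resolventFun A (Complex.I * (ω : ℂ)) := by
    refine continuous_iff_continuousAt.2 fun ω => ?_
    obtain ⟨U, hU⟩ := hA.isUnit (z := Complex.I * (ω : ℂ)) (by simp)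
    have h1 := NormedRing.inverse_continuousAt U
    rw [hU] at h1
    have h2 : Continuous fun ω : ℝ =>
        (Complex.I * (ω : ℂ)) • (1 : Matrix ι ι ℂ) - A.map Complex.ofReal := by fun_prop
    have h3 := ContinuousAt.comp (f := fun ω : ℝ =>
        (Complex.I * (ω : ℂ)) • (1 : Matrix ι ι ℂ) - A.map Complex.ofReal) h1 h2.continuousAt
    refine h3.congr (Eventually.of_forall fun t => ?_)
    simp only [Function.comp_apply, resolventFun, nonsing_inv_eq_ringInverse]
  have hlim : Tendsto (fun ω : ℝ => resolventFun A (Complex.I * (ω : ℂ))) (cocompact ℝ) (𝓝 0) := by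
    simp only [e]
    refine (spectrum.resolvent_tendsto_cobounded (𝕜 := ℂ) (A.map Complex.ofReal)).comp ?_
    rw [← Metric.cobounded_eq_cocompact, ← tendsto_norm_atTop_iff_cobounded]
    refine tendsto_norm_cobounded_atTop.congr fun ω => ?_
    simp
  have h1 := hlim.norm.eventually_lt_const (u := 1) (by rw [norm_zero]; exact one_pos)
  obtain ⟨K, hK, hKs⟩ := mem_cocompact.1 h1
  obtain ⟨M, hM⟩ := hK.exists_bound_of_continuousOn hcont.continuousOn
  refine ⟨max M 1, fun ω => ?_⟩
  by_cases hω : ω ∈ K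
  · exact (hM ω hω).trans (le_max_left _ _)
  · exact (show ‖_‖ < (1 : ℝ) from hKs hω).le.trans (le_max_right _ _)

/-- Gelfand's formula: `‖T ^ n‖` is eventually below `r ^ n` for some `r < 1`. -/
theorem tendsto_pow_zero_of_spectrum [Nonempty ι] {T : Matrix ι ι ℂ}
    (h : ∀ z ∈ spectrum ℂ T, ‖z‖ < 1) : Tendsto (fun n : ℕ => T ^ n) atTop (𝓝 0) := by
  have h1 : spectralRadius ℂ T < (1 : NNReal) :=
    spectrum.spectralRadius_lt_of_forall_lt T fun z hz => by
      have := h z hz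
      rwa [← NNReal.coe_lt_coe]
  obtain ⟨r, hr1, hr2⟩ := ENNReal.lt_iff_exists_nnreal_btwn.1 h1
  have h2 := (spectrum.pow_nnnorm_pow_one_div_tendsto_nhds_spectralRadius T).eventually
    (gt_mem_nhds hr1)
  rw [tendsto_zero_iff_norm_tendsto_zero]
  have hr : (r : ℝ) < 1 := by exact_mod_cast hr2
  refine squeeze_zero' (Eventually.of_forall fun n => norm_nonneg _) ?_
    (tendsto_pow_atTop_nhds_zero_of_lt_one r.2 hr)
  filter_upwards [h2, eventually_gt_atTop 0] with n hn hn0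
  have h3 : (‖T ^ n‖₊ : ENNReal) < (r : ENNReal) ^ n := by
    have h4 := ENNReal.rpow_lt_rpow hn (z := (n : ℝ)) (by exact_mod_cast hn0)
    rw [← ENNReal.rpow_mul, one_div, inv_mul_cancel₀ (by exact_mod_cast hn0.ne'),
      ENNReal.rpow_one, ENNReal.rpow_natCast] at h4
    exact h4
  have h5 : ‖T ^ n‖₊ < r ^ n := by exact_mod_cast h3
  exact_mod_cast h5.le

/-- The Cayley transform carries the open left half-plane into the unit disc: `(z - T)(1 - A) = (z -
1) - (z + 1) A`, and `(z - 1) / (z + 1)` has nonnegative real part when `‖z‖ ≥ 1` and `z ≠ -1`. -/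
theorem norm_lt_one_of_mem_spectrum_cayley {A T : Matrix ι ι ℝ} (hA : IsHurwitz A)
    (hT : T * (1 - A) = 1 + A) : ∀ z ∈ spectrum ℂ (T.map Complex.ofReal), ‖z‖ < 1 := by
  intro z hz
  by_contra! h
  refine hz ?_
  have hTc : T.map Complex.ofReal * (1 - A.map Complex.ofReal) = 1 + A.map Complex.ofReal := by
    have := congrArg (Complex.ofRealHom.mapMatrix) hT
    rwa [map_mul, map_sub, map_add, map_one] at this
  have e : (z • (1 : Matrix ι ι ℂ) - T.map Complex.ofReal) * (1 - A.map Complex.ofReal)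
      = (z - 1) • (1 : Matrix ι ι ℂ) - (z + 1) • A.map Complex.ofReal := by
    rw [Matrix.sub_mul, hTc, Matrix.smul_mul, Matrix.one_mul, smul_sub, sub_smul, add_smul,
      one_smul, one_smul]
    abel
  have hu : IsUnit ((z - 1) • (1 : Matrix ι ι ℂ) - (z + 1) • A.map Complex.ofReal) := by
    by_cases hz1 : z + 1 = 0
    · rw [hz1, zero_smul, sub_zero]
      have : z - 1 ≠ 0 := by
        rw [eq_neg_of_add_eq_zero_left hz1]; norm_num
      exact (isUnit_one).smul (Units.mk0 _ this)
    · have h1 : 0 ≤ ((z - 1) / (z + 1)).re := by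
        rw [Complex.div_re, ← add_div]
        refine div_nonneg ?_ (Complex.normSq_nonneg _)
        have h2 : 1 ≤ z.re * z.re + z.im * z.im := by
          rw [← Complex.normSq_apply, ← Complex.sq_norm]
          nlinarith
        simp
        nlinarith
      have h3 := (hA.isUnit h1).smul (Units.mk0 _ hz1)
      rw [Units.smul_mk0, smul_sub, smul_smul, mul_div_cancel₀ _ hz1] at h3
      exact h3
  rw [← e, isUnit_iff_isUnit_det, det_mul] at hu
  rw [spectrum.mem_resolventSet_iff, Algebra.algebraMap_eq_smul_one, isUnit_iff_isUnit_det]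
  exact isUnit_of_mul_isUnit_left hu

/-- Lyapunov: a symmetric `Q` with `Q A + Aᵀ Q` negative definite and `A` Hurwitz is positive. -/
theorem posDef_of_lyapunov {A Q : Matrix ι ι ℝ} (hA : IsHurwitz A) (hQ : Qᵀ = Q)
    (h : ∀ v : ι → ℝ, v ≠ 0 → (Q *ᵥ v) ⬝ᵥ (A *ᵥ v) < 0) : Q.PosDef := by
  refine posDef_of_forms hQ fun v hv => ?_
  by_contra! hneg
  have hne : Nonempty ι := by
    by_contra hne
    rw [not_nonempty_iff] at hne
    exact hv (Subsingleton.elim _ _)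
  have hdet : IsUnit (1 - A).det := by
    have := hA.det_ne_zero zero_le_one
    rw [one_smul] at this
    exact this.isUnit
  -- Powers of the Cayley transform replace the flow `exp (t A)`. With `x = (1 - A) y` the form of
  -- `Q` changes by `4 (Q y) ⬝ᵥ (A y) < 0` from `x` to `T x`, while `T ^ n v → 0`; hence the form is
  -- nonnegative at `T v` and positive at `v`.
  set T := (1 + A) * (1 - A)⁻¹ with hTdef
  have hT : T * (1 - A) = 1 + A := by rw [hTdef, Matrix.mul_assoc, nonsing_inv_mul _ hdet,
    Matrix.mul_one]
  have hdec : ∀ x : ι → ℝ, x ≠ 0 → (T *ᵥ x) ⬝ᵥ Q *ᵥ (T *ᵥ x) < x ⬝ᵥ Q *ᵥ x := by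
    intro x hx
    set y := (1 - A)⁻¹ *ᵥ x
    have hxy : x = y - A *ᵥ y := by
      have : (1 - A) *ᵥ y = x := by rw [mulVec_mulVec, mul_nonsing_inv _ hdet, one_mulVec]
      rw [← this, sub_mulVec, one_mulVec]
    have hTx : T *ᵥ x = y + A *ᵥ y := by
      rw [hTdef, ← mulVec_mulVec, add_mulVec, one_mulVec]
    have hy : y ≠ 0 := by
      intro hy; apply hx; rw [hxy, hy]; simp
    have h1 := h y hy
    rw [hTx, hxy]
    simp only [mulVec_add, mulVec_sub, add_dotProduct, dotProduct_add, sub_dotProduct,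
      dotProduct_sub]
    have e1 : y ⬝ᵥ Q *ᵥ A *ᵥ y = (Q *ᵥ y) ⬝ᵥ (A *ᵥ y) := by
      rw [dotProduct_mulVec_eq_transpose, hQ]
    have e2 : (A *ᵥ y) ⬝ᵥ Q *ᵥ y = (Q *ᵥ y) ⬝ᵥ (A *ᵥ y) := dotProduct_comm _ _
    linarith
  have hle : ∀ x : ι → ℝ, (T *ᵥ x) ⬝ᵥ Q *ᵥ (T *ᵥ x) ≤ x ⬝ᵥ Q *ᵥ x := by
    intro x
    by_cases hx : x = 0
    · simp [hx]
    · exact (hdec x hx).le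
  have hmono : ∀ n : ℕ, ((T ^ (n + 1)) *ᵥ v) ⬝ᵥ Q *ᵥ ((T ^ (n + 1)) *ᵥ v)
      ≤ (T *ᵥ v) ⬝ᵥ Q *ᵥ (T *ᵥ v) := by
    intro n
    induction n with
    | zero => simp
    | succ n ih =>
      refine le_trans ?_ ih
      have := hle ((T ^ (n + 1)) *ᵥ v)
      rwa [mulVec_mulVec, ← pow_succ'] at this
  have hpow : Tendsto (fun n : ℕ => T ^ n) atTop (𝓝 0) := by
    rw [tendsto_zero_iff_norm_tendsto_zero]
    have h1 := (tendsto_pow_zero_of_spectrum (norm_lt_one_of_mem_spectrum_cayley hA hT)).norm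
    rw [norm_zero] at h1
    refine squeeze_zero (fun n => norm_nonneg _) (fun n => ?_) h1
    have e : (T.map Complex.ofReal) ^ n = (T ^ n).map Complex.ofReal :=
      (map_pow Complex.ofRealHom.mapMatrix T n).symm
    rw [e]
    exact l2_opNorm_le_map_ofReal _
  have hc : Continuous fun M : Matrix ι ι ℝ => (M *ᵥ v) ⬝ᵥ Q *ᵥ (M *ᵥ v) :=
    (continuous_id.matrix_mulVec continuous_const).dotProduct
      (continuous_const.matrix_mulVec (continuous_id.matrix_mulVec continuous_const))
  have hlim := ((hc.tendsto 0).comp hpow).comp (tendsto_add_atTop_nat 1)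
  have h0 : (0 : ℝ) ≤ (T *ᵥ v) ⬝ᵥ Q *ᵥ (T *ᵥ v) := by
    have := le_of_tendsto hlim (Eventually.of_forall hmono)
    simpa using this
  linarith [hdec v hv]

end Hurwitz

/-! ### Metzler matrices and positive systems -/

section Metzler
variable {ι : Type*} [Fintype ι] [DecidableEq ι]

/-- For a Metzler matrix without nonnegative real eigenvalues, `-M x = b > 0` has a positive
solution. -/
theorem exists_pos_solution {M : Matrix ι ι ℝ} (hoff : ∀ i j, i ≠ j → 0 ≤ M i j)
    (hdet : ∀ s : ℝ, 0 ≤ s → (s • (1 : Matrix ι ι ℝ) - M).det ≠ 0) {b : ι → ℝ}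
    (hb : ∀ i, 0 < b i) : ∃ x : ι → ℝ, (∀ i, 0 < x i) ∧ M *ᵥ x = -b := by
  -- Homotopy from the identity (`t = 1`, solution `b`) to `-M` (`t = 0`), invertible throughout.
  -- The parameters with positive solution form an open set; it is also closed, because a
  -- nonnegative solution cannot vanish in a coordinate.
  let N : unitInterval → Matrix ι ι ℝ := fun t => (t : ℝ) • (1 : Matrix ι ι ℝ) - (1 - (t : ℝ)) • M
  have hN : ∀ t, IsUnit (N t).det := by
    intro t
    rw [isUnit_iff_ne_zero]
    rcases eq_or_lt_of_le t.2.2 with h | h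
    · simp [N, h]
    · have h1 : 0 < 1 - (t : ℝ) := by linarith
      have e : N t = (1 - (t : ℝ)) • (((t : ℝ) / (1 - t)) • (1 : Matrix ι ι ℝ) - M) := by
        rw [smul_sub, smul_smul, mul_div_cancel₀ _ h1.ne']
      rw [e, det_smul]
      exact mul_ne_zero (pow_ne_zero _ h1.ne') (hdet _ (div_nonneg t.2.1 h1.le))
  let x : unitInterval → ι → ℝ := fun t => (N t)⁻¹ *ᵥ b
  have hNx : ∀ t, N t *ᵥ x t = b := fun t => by
    rw [mulVec_mulVec, mul_nonsing_inv _ (hN t), one_mulVec]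
  have hx : Continuous x := by
    have hNc : Continuous N := by
      refine Continuous.sub ?_ ?_
      · exact (continuous_subtype_val).smul continuous_const
      · exact (continuous_const.sub continuous_subtype_val).smul continuous_const
    have : Continuous fun t => (N t)⁻¹ := by
      simp only [inv_def, Ring.inverse_eq_inv']
      exact (hNc.matrix_det.inv₀ fun t => (hN t).ne_zero).smul hNc.matrix_adjugate
    exact this.matrix_mulVec continuous_const
  have hpos : ∀ t, (∀ i, 0 ≤ x t i) → ∀ i, 0 < x t i := by
    intro t h i
    refine lt_of_le_of_ne (h i) fun h0 => ?_
    have h1 := congrFun (hNx t) i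
    simp only [N, sub_mulVec, smul_mulVec, one_mulVec, Pi.sub_apply, Pi.smul_apply, smul_eq_mul,
      ← h0, mul_zero, zero_sub] at h1
    have h2 : 0 ≤ (M *ᵥ x t) i := by
      refine Finset.sum_nonneg fun j _ => ?_
      by_cases hij : i = j
      · subst hij; rw [← h0, mul_zero]
      · exact mul_nonneg (hoff i j hij) (h j)
    have h3 : 0 ≤ 1 - (t : ℝ) := by linarith [t.2.2]
    have := mul_nonneg h3 h2
    linarith [hb i]
  have hclopen : IsClopen {t | ∀ i, 0 < x t i} := by
    constructor
    · have : {t | ∀ i, 0 < x t i} = {t | ∀ i, 0 ≤ x t i} :=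
        Set.Subset.antisymm (fun t h i => (h i).le) fun t h => hpos t h
      rw [this]
      simp only [Set.ofPred_forall]
      exact isClosed_iInter fun i => isClosed_le continuous_const ((continuous_apply i).comp hx)
    · simp only [Set.ofPred_forall]
      exact isOpen_iInter_of_finite fun i => isOpen_lt continuous_const ((continuous_apply i).comp hx)
  have huniv := hclopen.eq_univ ⟨1, fun i => by
    have : x 1 = b := by
      have := hNx 1
      simpa [N] using this
    rw [this]; exact hb i⟩
  refine ⟨x 0, fun i => (huniv ▸ Set.mem_univ (0 : unitInterval) : (0 : unitInterval) ∈ {t | ∀ i, 0 < x t i}) i, ?_⟩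
  have := hNx 0
  simp only [N, Set.Icc.coe_zero, zero_smul, sub_zero, one_smul, zero_sub, neg_mulVec] at this
  rw [← this, neg_neg]

theorem isUnit_det_neg {M : Matrix ι ι ℝ}
    (hdet : ∀ s : ℝ, 0 ≤ s → (s • (1 : Matrix ι ι ℝ) - M).det ≠ 0) : IsUnit (-M).det := by
  have := hdet 0 le_rfl
  rw [zero_smul, zero_sub] at this
  exact this.isUnit

theorem neg_inv_mulVec_pos {M : Matrix ι ι ℝ} (hoff : ∀ i j, i ≠ j → 0 ≤ M i j)
    (hdet : ∀ s : ℝ, 0 ≤ s → (s • (1 : Matrix ι ι ℝ) - M).det ≠ 0) {b : ι → ℝ}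
    (hb : ∀ i, 0 < b i) (i : ι) : 0 < ((-M)⁻¹ *ᵥ b) i := by
  obtain ⟨x, hx, hMx⟩ := exists_pos_solution hoff hdet hb
  have : (-M)⁻¹ *ᵥ b = x := by
    rw [← neg_neg b, ← hMx, ← neg_mulVec, mulVec_mulVec, nonsing_inv_mul _ (isUnit_det_neg hdet),
      one_mulVec]
  rw [this]; exact hx i

/-- The inverse sends positive vectors to positive ones; apply this to `eⱼ` plus a small positive
vector and let the perturbation tend to zero. -/
theorem neg_inv_nonneg {M : Matrix ι ι ℝ} (hoff : ∀ i j, i ≠ j → 0 ≤ M i j)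
    (hdet : ∀ s : ℝ, 0 ≤ s → (s • (1 : Matrix ι ι ℝ) - M).det ≠ 0) (i j : ι) :
    0 ≤ (-M)⁻¹ i j := by
  set c := ((-M)⁻¹ *ᵥ 1) i with hc
  have hc0 : 0 < c := neg_inv_mulVec_pos hoff hdet (b := 1) (fun _ => one_pos) i
  refine le_of_forall_pos_le_add fun ε hε => ?_
  have hη : 0 < ε / c := by positivity
  have h1 := neg_inv_mulVec_pos hoff hdet (b := Pi.single j 1 + (ε / c) • 1) (fun k => by
    have : (0 : ℝ) ≤ (Pi.single j 1 : ι → ℝ) k := by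
      by_cases h : k = j
      · subst h; simp
      · simp [h]
    simp only [Pi.add_apply, Pi.smul_apply, Pi.one_apply, smul_eq_mul, mul_one]
    linarith) i
  rw [mulVec_add, mulVec_smul, Pi.add_apply, Pi.smul_apply, ← hc, mulVec_single_one, smul_eq_mul,
    div_mul_cancel₀ _ hc0.ne'] at h1
  exact h1.le

theorem mul_nonneg_entries {l m n : Type*} [Fintype m] {X : Matrix l m ℝ} {Y : Matrix m n ℝ}
    (hX : ∀ i j, 0 ≤ X i j) (hY : ∀ i j, 0 ≤ Y i j) (i : l) (j : n) : 0 ≤ (X * Y) i j :=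
  Finset.sum_nonneg fun k _ => mul_nonneg (hX i k) (hY k j)

theorem mulVec_nonneg_entries {l m : Type*} [Fintype m] {X : Matrix l m ℝ} {v : m → ℝ}
    (hX : ∀ i j, 0 ≤ X i j) (hv : ∀ j, 0 ≤ v j) (i : l) : 0 ≤ (X *ᵥ v) i :=
  Finset.sum_nonneg fun k _ => mul_nonneg (hX i k) (hv k)

/-- A positive system with static gain below `δ` admits positive vectors that certify it. -/
theorem exists_positive_certificate {μ π : Type*} [Fintype μ] [DecidableEq μ] [Fintype π]
    {F : Matrix ι ι ℝ} {G : Matrix ι μ ℝ}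
    {H : Matrix π ι ℝ} {J : Matrix π μ ℝ} (hF : ∀ i j, i ≠ j → 0 ≤ F i j)
    (hdet : ∀ s : ℝ, 0 ≤ s → (s • (1 : Matrix ι ι ℝ) - F).det ≠ 0)
    (hG : ∀ i j, 0 ≤ G i j) (hH : ∀ i j, 0 ≤ H i j) (hJ : ∀ i j, 0 ≤ J i j) {δ : ℝ}
    (hδ : ‖H * (-F)⁻¹ * G + J‖ < δ) :
    ∃ (x z : ι → ℝ) (u : μ → ℝ) (w : π → ℝ), (∀ i, 0 < x i) ∧ (∀ i, 0 < z i) ∧ (∀ i, 0 < u i) ∧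
      (∀ i, 0 < w i) ∧ (∀ i, (F *ᵥ x) i + (G *ᵥ u) i < 0) ∧ (∀ i, (H *ᵥ x) i + (J *ᵥ u) i ≤ w i) ∧
      (∀ i, (Fᵀ *ᵥ z) i + (Hᵀ *ᵥ w) i < 0) ∧
      (∀ i, (Gᵀ *ᵥ z) i + (Jᵀ *ᵥ w) i < δ ^ 2 * u i) := by
  set R := (-F)⁻¹ with hR
  have hFR : F * R = -1 := by
    have := mul_nonsing_inv _ (isUnit_det_neg hdet)
    rw [Matrix.neg_mul] at this
    rw [← this, neg_neg]
  have hFRt : Fᵀ * Rᵀ = -1 := by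
    have h1 := nonsing_inv_mul _ (isUnit_det_neg hdet)
    rw [Matrix.mul_neg] at h1
    rw [← transpose_mul, ← neg_neg (R * F), h1, transpose_neg, transpose_one]
  have hR0 : ∀ i j, 0 ≤ R i j := neg_inv_nonneg hF hdet
  have hRpos : ∀ b : ι → ℝ, (∀ i, 0 < b i) → ∀ i, 0 < (R *ᵥ b) i :=
    fun b hb => neg_inv_mulVec_pos hF hdet hb
  have hRtpos : ∀ b : ι → ℝ, (∀ i, 0 < b i) → ∀ i, 0 < (Rᵀ *ᵥ b) i := by
    intro b hb i
    have e : Rᵀ = (-Fᵀ)⁻¹ := by rw [hR, transpose_nonsing_inv, transpose_neg]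
    rw [e]
    refine neg_inv_mulVec_pos (M := Fᵀ) (fun i j hij => hF j i hij.symm) (fun s hs => ?_) hb i
    rw [← det_transpose, transpose_sub, transpose_smul, transpose_one, transpose_transpose]
    exact hdet s hs
  set K := H * R * G + J with hK
  have hK0 : ∀ i j, 0 ≤ K i j := fun i j =>
    add_nonneg (mul_nonneg_entries (mul_nonneg_entries hH hR0) hG i j) (hJ i j)
  have hδ0 : 0 < δ := (norm_nonneg _).trans_lt hδ
  -- `Kᵀ K - δ²` is Metzler, and `‖K‖ < δ` excludes nonnegative real eigenvalues. The resulting `u`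
  -- satisfies `Kᵀ K u = δ² u - 1`, and the slack `1` pays for the perturbations below.
  obtain ⟨u, hu, hKu⟩ := exists_pos_solution (M := Kᵀ * K - δ ^ 2 • 1) (b := 1)
    (fun i j hij => by
      simpa [hij] using mul_nonneg_entries (X := Kᵀ) (fun i j => hK0 j i) hK0 i j)
    (fun s hs h => by
      obtain ⟨v, hv, hv0⟩ := exists_mulVec_eq_zero_iff.2 h
      have h1 := mulVec_dotProduct_self_le K v
      have h2 := congrArg (v ⬝ᵥ ·) hv0
      simp only [sub_mulVec, smul_mulVec, one_mulVec, dotProduct_sub, dotProduct_smul,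
        dotProduct_zero, smul_eq_mul, ← mulVec_mulVec] at h2
      rw [dotProduct_mulVec_eq_transpose, transpose_transpose] at h2
      have h3 := dotProduct_self_pos hv
      have h4 : ‖K‖ ^ 2 < δ ^ 2 := pow_lt_pow_left₀ hδ (norm_nonneg _) two_ne_zero
      nlinarith)
    (fun _ => one_pos)
  -- Perturbing by `ε` makes the state inequalities strict. The summand `1` in `a` keeps `w = K u +
  -- ε a` positive even where `K u` vanishes, and `ε e` is the total effect on the input inequality.
  set a := H *ᵥ (R *ᵥ 1) + 1 with ha
  set e := Kᵀ *ᵥ a + Gᵀ *ᵥ (Rᵀ *ᵥ 1) with he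
  have ha0 : ∀ i, 0 < a i := fun i => by
    have := mulVec_nonneg_entries hH (fun j => (hRpos 1 (fun _ => one_pos) j).le) i
    simp only [ha, Pi.add_apply, Pi.one_apply]; linarith
  obtain ⟨ε, hε, hεe⟩ : ∃ ε : ℝ, 0 < ε ∧ ∀ i, ε * e i < 1 := by
    refine ⟨(1 + ∑ i, |e i|)⁻¹, by positivity, fun i => ?_⟩
    have h1 : |e i| ≤ ∑ i, |e i| :=
      Finset.single_le_sum (f := fun i => |e i|) (fun _ _ => abs_nonneg _) (Finset.mem_univ i)
    have h2 : 0 ≤ ∑ i, |e i| := (abs_nonneg _).trans h1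
    rw [inv_mul_eq_div, div_lt_one (by positivity)]
    linarith [le_abs_self (e i)]
  have hw0 : ∀ i, 0 < (K *ᵥ u + ε • a) i := fun i => by
    have := mulVec_nonneg_entries hK0 (fun j => (hu j).le) i
    have := mul_pos hε (ha0 i)
    simp only [Pi.add_apply, Pi.smul_apply, smul_eq_mul]; linarith
  refine ⟨R *ᵥ (G *ᵥ u + ε • 1), Rᵀ *ᵥ (Hᵀ *ᵥ (K *ᵥ u + ε • a) + ε • 1), u, K *ᵥ u + ε • a,
    hRpos _ fun i => ?_, hRtpos _ fun i => ?_, hu, hw0, fun i => ?_, fun i => ?_, fun i => ?_,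
    fun i => ?_⟩
  · have := mulVec_nonneg_entries hG (fun j => (hu j).le) i
    simp only [Pi.add_apply, Pi.smul_apply, Pi.one_apply, smul_eq_mul]; linarith
  · have := mulVec_nonneg_entries (X := Hᵀ) (fun i j => hH j i) (fun j => (hw0 j).le) i
    rw [Pi.add_apply]
    simp only [Pi.smul_apply, Pi.one_apply, smul_eq_mul]; linarith
  · rw [mulVec_mulVec, hFR]
    simp [neg_mulVec, hε]
  · have : H *ᵥ (R *ᵥ (G *ᵥ u + ε • 1)) + J *ᵥ u = K *ᵥ u + ε • (H *ᵥ (R *ᵥ 1)) := by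
      simp only [hK, mulVec_add, mulVec_smul, add_mulVec, ← mulVec_mulVec]; abel
    have := congrFun this i
    rw [Pi.add_apply] at this
    rw [this]
    simp [ha, hε.le]
  · rw [mulVec_mulVec, hFRt]
    simp [neg_mulVec, hε]
  · have h1 : Gᵀ *ᵥ (Rᵀ *ᵥ (Hᵀ *ᵥ (K *ᵥ u + ε • a) + ε • 1)) + Jᵀ *ᵥ (K *ᵥ u + ε • a)
        = (Kᵀ * K) *ᵥ u + ε • e := by
      have : Kᵀ = Gᵀ * (Rᵀ * Hᵀ) + Jᵀ := by simp [hK, Matrix.mul_assoc]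
      simp only [he, this, mulVec_add, mulVec_smul, add_mulVec, ← mulVec_mulVec, smul_add]; abel
    have h2 := congrFun h1 i
    have h3 := congrFun hKu i
    simp only [sub_mulVec, smul_mulVec, one_mulVec, Pi.sub_apply, Pi.smul_apply, Pi.neg_apply,
      Pi.one_apply, Pi.add_apply, smul_eq_mul] at h2 h3
    rw [h2]
    linarith [hεe i]

theorem transferFun_zero {μ π : Type*}
    {F : Matrix ι ι ℝ} (G : Matrix ι μ ℝ) (H : Matrix π ι ℝ) (J : Matrix π μ ℝ)
    (hF : IsUnit (-F).det) :
    transferFun F G H J (Complex.I * ((0 : ℝ) : ℂ)) = (H * (-F)⁻¹ * G + J).map Complex.ofReal := by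
  have e : resolventFun F (Complex.I * ((0 : ℝ) : ℂ)) = ((-F)⁻¹).map Complex.ofReal := by
    rw [resolventFun]
    refine inv_eq_right_inv ?_
    have := congrArg Complex.ofRealHom.mapMatrix (mul_nonsing_inv _ hF)
    rw [map_mul, map_neg, map_one] at this
    rw [Complex.ofReal_zero, mul_zero, zero_smul, zero_sub]
    exact this
  rw [transferFun, e]
  ext i j
  simp [mul_apply]

end Metzler

/-! ### What dissipativity implies -/

section Consequences
variable {ι μ π : Type*} [Fintype ι] [Fintype μ] [DecidableEq μ] [Fintype π]
  {A : Matrix ι ι ℝ} {B : Matrix ι μ ℝ} {C : Matrix π ι ℝ} {D : Matrix π μ ℝ} {P : Matrix ι ι ℝ}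
  {δ : ℝ}

/-- The system dissipates the supply rate `δ² |u|² - |y|²` with storage function `x ↦ xᵀ P x`. -/
def Dissipative (A : Matrix ι ι ℝ) (B : Matrix ι μ ℝ) (C : Matrix π ι ℝ) (D : Matrix π μ ℝ)
    (P : Matrix ι ι ℝ) (δ : ℝ) : Prop :=
  ∀ (x : ι → ℝ) (u : μ → ℝ), 2 * ((P *ᵥ x) ⬝ᵥ (A *ᵥ x + B *ᵥ u))
    + (C *ᵥ x + D *ᵥ u) ⬝ᵥ (C *ᵥ x + D *ᵥ u) ≤ δ ^ 2 * (u ⬝ᵥ u)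

theorem Dissipative.norm_feedthrough_le (h : Dissipative A B C D P δ) (hδ : 0 ≤ δ) : ‖D‖ ≤ δ :=
  l2_opNorm_le_of_dotProduct D hδ fun v => by simpa using h 0 v

/-- Add the dissipation inequalities for the real and imaginary parts of a harmonic solution `iω x =
A x + B u`: the storage terms cancel because `P` is symmetric. -/
theorem Dissipative.norm_transferFun_le [DecidableEq ι] (h : Dissipative A B C D P δ) (hP : Pᵀ = P) (hδ : 0 ≤ δ)
    (hA : IsHurwitz A) (ω : ℝ) : ‖transferFun A B C D (Complex.I * (ω : ℂ))‖ ≤ δ := by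
  refine l2_opNorm_le_of_mulVec _ hδ fun u => ?_
  set N := (Complex.I * (ω : ℂ)) • (1 : Matrix ι ι ℂ) - A.map Complex.ofReal
  have hN : IsUnit N.det := (isUnit_iff_isUnit_det _).1 (hA.isUnit (by simp))
  set x := resolventFun A (Complex.I * (ω : ℂ)) *ᵥ (B.map Complex.ofReal *ᵥ u) with hx
  have hNx : A.map Complex.ofReal *ᵥ x + B.map Complex.ofReal *ᵥ u = (Complex.I * (ω : ℂ)) • x := by
    have : N *ᵥ x = B.map Complex.ofReal *ᵥ u := by
      rw [hx, resolventFun, mulVec_mulVec, mul_nonsing_inv _ hN, one_mulVec]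
    rw [← this, sub_mulVec, smul_mulVec, one_mulVec]
    abel
  have hy : transferFun A B C D (Complex.I * (ω : ℂ)) *ᵥ u
      = C.map Complex.ofReal *ᵥ x + D.map Complex.ofReal *ᵥ u := by
    rw [transferFun, add_mulVec, hx, mulVec_mulVec, mulVec_mulVec]
  rw [hy]
  have hre := h (fun i => (x i).re) (fun i => (u i).re)
  have him := h (fun i => (x i).im) (fun i => (u i).im)
  have e1 : A *ᵥ (fun i => (x i).re) + B *ᵥ (fun i => (u i).re) = (-ω) • fun i => (x i).im := by
    rw [← re_map_ofReal_mulVec, ← re_map_ofReal_mulVec]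
    ext i
    have := congrArg Complex.re (congrFun hNx i)
    simpa using this
  have e2 : A *ᵥ (fun i => (x i).im) + B *ᵥ (fun i => (u i).im) = ω • fun i => (x i).re := by
    rw [← im_map_ofReal_mulVec, ← im_map_ofReal_mulVec]
    ext i
    have := congrArg Complex.im (congrFun hNx i)
    simpa using this
  have e3 : C *ᵥ (fun i => (x i).re) + D *ᵥ (fun i => (u i).re)
      = fun q => ((C.map Complex.ofReal *ᵥ x + D.map Complex.ofReal *ᵥ u) q).re := by
    rw [← re_map_ofReal_mulVec, ← re_map_ofReal_mulVec]; rfl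
  have e4 : C *ᵥ (fun i => (x i).im) + D *ᵥ (fun i => (u i).im)
      = fun q => ((C.map Complex.ofReal *ᵥ x + D.map Complex.ofReal *ᵥ u) q).im := by
    rw [← im_map_ofReal_mulVec, ← im_map_ofReal_mulVec]; rfl
  rw [e1, e3] at hre
  rw [e2, e4] at him
  have e5 : (P *ᵥ fun i => (x i).im) ⬝ᵥ (fun i => (x i).re)
      = (P *ᵥ fun i => (x i).re) ⬝ᵥ (fun i => (x i).im) := by
    rw [dotProduct_comm, dotProduct_mulVec_eq_transpose, hP]
  simp only [dotProduct_smul, smul_eq_mul, e5] at hre him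
  refine le_of_sq_le_sq ?_ (by positivity)
  rw [mul_pow, norm_toLp_sq_complex, norm_toLp_sq_complex]
  linarith

/-- For an eigenvector `a + i b` with eigenvalue `z`, the forms at `a` and `b` add up to `z.re * (aᵀ
P a + bᵀ P b)`. -/
theorem isHurwitz_of_lyapunov [DecidableEq ι] (hP : P.PosDef)
    (h : ∀ v : ι → ℝ, v ≠ 0 → (P *ᵥ v) ⬝ᵥ (A *ᵥ v) < 0) : IsHurwitz A := by
  refine isHurwitz_of_eigenvectors fun z x hx hAx => ?_
  set a : ι → ℝ := fun i => (x i).re with ha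
  set b : ι → ℝ := fun i => (x i).im with hb
  have e1 : A *ᵥ a = z.re • a - z.im • b := by
    rw [ha, ← re_map_ofReal_mulVec, hAx]
    ext i; simp [hb]
  have e2 : A *ᵥ b = z.re • b + z.im • a := by
    rw [hb, ← im_map_ofReal_mulVec, hAx]
    ext i; simp [ha]
  have e3 : (P *ᵥ b) ⬝ᵥ a = (P *ᵥ a) ⬝ᵥ b := by
    rw [dotProduct_comm, dotProduct_mulVec_eq_transpose, hP.transpose_eq]
  have hle : ∀ v : ι → ℝ, (P *ᵥ v) ⬝ᵥ (A *ᵥ v) ≤ 0 := fun v => by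
    by_cases hv : v = 0
    · simp [hv]
    · exact (h v hv).le
  have hP0 : ∀ v : ι → ℝ, 0 ≤ (P *ᵥ v) ⬝ᵥ v := fun v => by
    by_cases hv : v = 0
    · simp [hv]
    · rw [dotProduct_comm]; exact (hP.form_pos hv).le
  have hsum : (P *ᵥ a) ⬝ᵥ (A *ᵥ a) + (P *ᵥ b) ⬝ᵥ (A *ᵥ b) < 0 := by
    by_cases h0 : a = 0
    · have hb0 : b ≠ 0 := by
        intro hb0
        apply hx
        ext i
        exact Complex.ext (congrFun h0 i) (congrFun hb0 i)
      linarith [hle a, h b hb0]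
    · linarith [hle b, h a h0]
  rw [e1, e2] at hsum
  simp only [dotProduct_add, dotProduct_sub, dotProduct_smul, smul_eq_mul, e3] at hsum
  by_contra! hz
  nlinarith [mul_nonneg hz (hP0 a), mul_nonneg hz (hP0 b)]

theorem posDef_neg_riccati (hP : Pᵀ = P) (hD : ‖D‖ < δ)
    (h : ∀ (x : ι → ℝ) (u : μ → ℝ), x ≠ 0 → 2 * ((P *ᵥ x) ⬝ᵥ (A *ᵥ x + B *ᵥ u))
      + (C *ᵥ x + D *ᵥ u) ⬝ᵥ (C *ᵥ x + D *ᵥ u) < δ ^ 2 * (u ⬝ᵥ u)) :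
    (-(riccati A B C D δ P)).PosDef := by
  set S := Dᵀ * D - δ ^ 2 • (1 : Matrix μ μ ℝ) with hS
  have hSt : Sᵀ = S := by simp [hS]
  have hneg : (-S).PosDef := by
    refine posDef_of_forms (by rw [transpose_neg, hSt]) fun v hv => ?_
    have h1 := mulVec_dotProduct_self_le D v
    have h2 := dotProduct_self_pos hv
    have h3 : ‖D‖ ^ 2 < δ ^ 2 := pow_lt_pow_left₀ hD (norm_nonneg _) two_ne_zero
    rw [hS, neg_mulVec, sub_mulVec, smul_mulVec, one_mulVec, ← mulVec_mulVec, dotProduct_neg,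
      dotProduct_sub, dotProduct_mulVec_eq_transpose, transpose_transpose, dotProduct_smul,
      smul_eq_mul]
    nlinarith
  have hSdet : IsUnit S.det := by
    have h2 := (hneg.isUnit).neg
    rw [neg_neg] at h2
    exact (isUnit_iff_isUnit_det _).1 h2
  have hSinv : S⁻¹ᵀ = S⁻¹ := by rw [transpose_nonsing_inv, hSt]
  refine posDef_of_forms ?_ fun v hv => ?_
  · simp only [riccati, transpose_neg, transpose_sub, transpose_add, transpose_mul,
      transpose_transpose, hP, ← hS, hSinv, Matrix.mul_assoc]
    congr 1
    rw [add_comm (Aᵀ * P), add_comm (Dᵀ * C), add_comm (Cᵀ * D)]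
  · set N := P * B + Cᵀ * D with hN
    have hNt : Dᵀ * C + Bᵀ * P = Nᵀ := by
      simp [hN, hP, add_comm]
    -- The worst input: as `S ≺ 0`, this `u` maximises the dissipation expression for fixed `v`, and
    -- the maximum is the Riccati form at `v`.
    set u := -(S⁻¹ *ᵥ (Nᵀ *ᵥ v)) with hu
    have hSu : S *ᵥ u = -(Nᵀ *ᵥ v) := by
      rw [hu, mulVec_neg, mulVec_mulVec, mul_nonsing_inv _ hSdet, one_mulVec]
    have h1 := h v u hv
    have e1 : v ⬝ᵥ (riccati A B C D δ P) *ᵥ v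
        = 2 * ((P *ᵥ v) ⬝ᵥ (A *ᵥ v)) + (C *ᵥ v) ⬝ᵥ (C *ᵥ v) + (Nᵀ *ᵥ v) ⬝ᵥ u := by
      rw [riccati, ← hS, ← hN, hNt, sub_mulVec, add_mulVec, add_mulVec, dotProduct_sub,
        dotProduct_add, dotProduct_add]
      simp only [← mulVec_mulVec]
      rw [dotProduct_mulVec_eq_transpose P, hP, dotProduct_mulVec_eq_transpose Aᵀ,
        dotProduct_mulVec_eq_transpose Cᵀ, dotProduct_mulVec_eq_transpose N,
        transpose_transpose, transpose_transpose, hu, dotProduct_neg,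
        dotProduct_comm (A *ᵥ v)]
      ring
    have e2 : (Nᵀ *ᵥ v) ⬝ᵥ u = (P *ᵥ v) ⬝ᵥ (B *ᵥ u) + (C *ᵥ v) ⬝ᵥ (D *ᵥ u) := by
      rw [← dotProduct_mulVec_eq_transpose, hN, add_mulVec, dotProduct_add, ← mulVec_mulVec,
        ← mulVec_mulVec, dotProduct_mulVec_eq_transpose P, hP, dotProduct_mulVec_eq_transpose Cᵀ,
        transpose_transpose]
    have e3 : (D *ᵥ u) ⬝ᵥ (D *ᵥ u) - δ ^ 2 * (u ⬝ᵥ u) = -((Nᵀ *ᵥ v) ⬝ᵥ u) := by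
      have : u ⬝ᵥ S *ᵥ u = -((Nᵀ *ᵥ v) ⬝ᵥ u) := by
        rw [hSu, dotProduct_neg, dotProduct_comm]
      rw [← this, hS, sub_mulVec, dotProduct_sub, smul_mulVec, one_mulVec, dotProduct_smul,
        smul_eq_mul, ← mulVec_mulVec, dotProduct_mulVec_eq_transpose Dᵀ, transpose_transpose]
    rw [neg_mulVec, dotProduct_neg, e1]
    simp only [dotProduct_add, add_dotProduct] at h1
    rw [dotProduct_comm (D *ᵥ u) (C *ᵥ v)] at h1
    linarith

end Consequences

/-! ### Riccati solutions for the diagonal blocks -/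

section Diagonal
variable {ι : Type*} [Fintype ι] [DecidableEq ι]

theorem form_le_mu2 (A : Matrix ι ι ℝ) (v : ι → ℝ) : v ⬝ᵥ A *ᵥ v ≤ mu2 A * (v ⬝ᵥ v) := by
  set S := (1 / 2 : ℝ) • (A + Aᵀ) with hS
  have hH : S.IsHermitian := by
    simp [hS, IsHermitian, add_comm]
  have hle : ∀ i, hH.eigenvalues i ≤ mu2 A := fun i =>
    le_csSup finite_real_spectrum.bddAbove (hH.eigenvalues_mem_spectrum_real i)
  obtain ⟨V, -, hV, hd⟩ := exists_orthogonal_diagonalization hH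
  have e1 : v ⬝ᵥ A *ᵥ v = v ⬝ᵥ S *ᵥ v := by
    rw [hS, smul_mulVec, add_mulVec, dotProduct_smul, dotProduct_add,
      dotProduct_mulVec_eq_transpose Aᵀ, transpose_transpose, dotProduct_comm (A *ᵥ v), smul_eq_mul]
    ring
  have e2 : v ⬝ᵥ S *ᵥ v = ∑ i, hH.eigenvalues i * ((Vᵀ *ᵥ v) i * (Vᵀ *ᵥ v) i) := by
    conv_lhs => rw [hd]
    rw [← mulVec_mulVec, ← mulVec_mulVec, dotProduct_mulVec_eq_transpose V]
    simp only [dotProduct, mulVec_diagonal]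
    exact Finset.sum_congr rfl fun i _ => by ring
  have e3 : v ⬝ᵥ v = ∑ i, (Vᵀ *ᵥ v) i * (Vᵀ *ᵥ v) i := by
    change _ = (Vᵀ *ᵥ v) ⬝ᵥ (Vᵀ *ᵥ v)
    rw [dotProduct_mulVec_eq_transpose Vᵀ, transpose_transpose, mulVec_mulVec, hV, one_mulVec]
  rw [e1, e2, e3, Finset.mul_sum]
  exact Finset.sum_le_sum fun i _ => mul_le_mul_of_nonneg_right (hle i) (mul_self_nonneg _)

/-- A bound on the resolvent or on the logarithmic norm yields a positive definite solution of
`Q A + Aᵀ Q + c (1 + Q²) < 0`. -/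
theorem exists_block_solution {A : Matrix ι ι ℝ} (hA : IsHurwitz A) {f c : ℝ} (hc : 0 < c)
    (hcf : c < -f) (hf : f = -(hinfNorm (resolventFun A))⁻¹ ∨ f = min (mu2 A) 0) :
    ∃ Q : Matrix ι ι ℝ, Q.PosDef ∧ ∀ v : ι → ℝ, v ≠ 0 →
      2 * ((Q *ᵥ v) ⬝ᵥ (A *ᵥ v)) + c * (v ⬝ᵥ v + (Q *ᵥ v) ⬝ᵥ (Q *ᵥ v)) < 0 := by
  rcases hf with rfl | rfl
  · rw [neg_neg] at hcf
    set g := hinfNorm (resolventFun A) with hg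
    -- Since `0⁻¹ = 0`, the bound `0 < c < g⁻¹` excludes `g = 0`.
    have hg0 : 0 < g := inv_pos.1 (hc.trans hcf)
    have hcg : c * g < 1 := by
      have := mul_lt_mul_of_pos_right hcf hg0
      rwa [inv_mul_cancel₀ hg0.ne'] at this
    obtain ⟨M, hM⟩ := hA.exists_resolvent_bound
    have hbdd : BddAbove (Set.range fun ω : ℝ => ‖resolventFun A (Complex.I * (ω : ℂ))‖) :=
      ⟨M, by rintro _ ⟨ω, rfl⟩; exact hM ω⟩
    obtain ⟨Q, hQ, h⟩ := exists_riccati_of_resolvent_bound A hc hg0.le hcg fun ω x u hxu => by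
      have h1 : ((Complex.I * (ω : ℂ)) • (1 : Matrix ι ι ℂ) - A.map Complex.ofReal) *ᵥ x = u := by
        rw [sub_mulVec, smul_mulVec, one_mulVec, ← hxu]; abel
      have hu : IsUnit ((Complex.I * (ω : ℂ)) • (1 : Matrix ι ι ℂ) - A.map Complex.ofReal).det :=
        (isUnit_iff_isUnit_det _).1 (hA.isUnit (by simp))
      have h2 : x = resolventFun A (Complex.I * (ω : ℂ)) *ᵥ u := by
        rw [← h1, resolventFun, mulVec_mulVec, nonsing_inv_mul _ hu, one_mulVec]
      have h3 := norm_toLp_mulVec_le (resolventFun A (Complex.I * (ω : ℂ))) u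
      rw [← h2] at h3
      have h4 : ‖resolventFun A (Complex.I * (ω : ℂ))‖ ≤ g := le_ciSup hbdd ω
      rw [← mul_pow]
      exact pow_le_pow_left₀ (norm_nonneg _)
        (h3.trans (mul_le_mul_of_nonneg_right h4 (norm_nonneg _))) 2
    refine ⟨Q, posDef_of_lyapunov hA hQ fun v hv => ?_, h⟩
    have := h v hv
    have h5 : 0 ≤ c * (v ⬝ᵥ v + (Q *ᵥ v) ⬝ᵥ (Q *ᵥ v)) :=
      mul_nonneg hc.le (add_nonneg (dotProduct_self_nonneg' _) (dotProduct_self_nonneg' _))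
    linarith
  · refine ⟨1, PosDef.one, fun v hv => ?_⟩
    have hmu : mu2 A < -c := by
      rcases min_lt_iff.1 (show min (mu2 A) 0 < -c by linarith) with h | h
      · exact h
      · linarith
    have h1 := form_le_mu2 A v
    have h2 := dotProduct_self_pos hv
    simp only [one_mulVec]
    nlinarith

end Diagonal

/-! ### Block vectors and weighted coupling estimates -/

section Blocks
variable {a b : ℕ} {r : Fin a → ℕ} {c : Fin b → ℕ}

/-- The `i`-th block of a block-partitioned vector. -/
def blockVec (x : (Σ i, Fin (r i)) → ℝ) (i : Fin a) : Fin (r i) → ℝ := fun t => x ⟨i, t⟩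

theorem dotProduct_eq_sum_blockVec (x y : (Σ i, Fin (r i)) → ℝ) :
    x ⬝ᵥ y = ∑ i, blockVec x i ⬝ᵥ blockVec y i :=
  Fintype.sum_sigma _

theorem blockVec_mulVec (X : Matrix (Σ i, Fin (r i)) (Σ j, Fin (c j)) ℝ)
    (x : (Σ j, Fin (c j)) → ℝ) (i : Fin a) :
    blockVec (X *ᵥ x) i = ∑ j, block X i j *ᵥ blockVec x j := by
  ext t
  simp only [Finset.sum_apply]
  exact Fintype.sum_sigma _

theorem blockVec_blockDiagonal'_mulVec (P : ∀ i, Matrix (Fin (r i)) (Fin (r i)) ℝ)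
    (x : (Σ i, Fin (r i)) → ℝ) (i : Fin a) :
    blockVec (blockDiagonal' P *ᵥ x) i = P i *ᵥ blockVec x i := by
  rw [blockVec_mulVec, Finset.sum_eq_single i]
  · congr 1
    ext s t
    simp [block, blockDiagonal'_apply_eq]
  · intro j _ hj
    have : block (blockDiagonal' P) i j = (0 : Matrix (Fin (r i)) (Fin (r j)) ℝ) := by
      ext s t
      exact blockDiagonal'_apply_ne P s t hj.symm
    rw [this, zero_mulVec]
  · simp

theorem exists_blockVec_ne_zero {x : (Σ i, Fin (r i)) → ℝ} (hx : x ≠ 0) : ∃ i, blockVec x i ≠ 0 := by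
  by_contra! h
  exact hx (funext fun t => congrFun (h t.1) t.2)

/-- Weighted Young inequality for all blocks of a matrix at once. -/
theorem two_mul_dotProduct_mulVec_le_blocks (X : Matrix (Σ i, Fin (r i)) (Σ j, Fin (c j)) ℝ)
    {s : Fin a → ℝ} {t : Fin b → ℝ} (hs : ∀ i, 0 < s i) (ht : ∀ j, 0 < t j)
    (p : (Σ i, Fin (r i)) → ℝ) (y : (Σ j, Fin (c j)) → ℝ) :
    2 * (p ⬝ᵥ X *ᵥ y) ≤ ∑ i, (blockNorms X *ᵥ t) i / s i * (blockVec p i ⬝ᵥ blockVec p i)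
      + ∑ j, ((blockNorms X)ᵀ *ᵥ s) j / t j * (blockVec y j ⬝ᵥ blockVec y j) := by
  have h1 : 2 * (p ⬝ᵥ X *ᵥ y)
      = ∑ i, ∑ j, 2 * (blockVec p i ⬝ᵥ block X i j *ᵥ blockVec y j) := by
    rw [dotProduct_eq_sum_blockVec, Finset.mul_sum]
    refine Finset.sum_congr rfl fun i _ => ?_
    rw [blockVec_mulVec, dotProduct_sum, Finset.mul_sum]
  have h2 : ∑ i, (blockNorms X *ᵥ t) i / s i * (blockVec p i ⬝ᵥ blockVec p i)
      = ∑ i, ∑ j, ‖block X i j‖ * (t j / s i * (blockVec p i ⬝ᵥ blockVec p i)) := by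
    refine Finset.sum_congr rfl fun i _ => ?_
    simp only [mulVec, dotProduct, blockNorms, of_apply]
    rw [Finset.sum_div, Finset.sum_mul]
    exact Finset.sum_congr rfl fun j _ => by ring
  have h3 : ∑ j, ((blockNorms X)ᵀ *ᵥ s) j / t j * (blockVec y j ⬝ᵥ blockVec y j)
      = ∑ i, ∑ j, ‖block X i j‖ * ((t j / s i)⁻¹ * (blockVec y j ⬝ᵥ blockVec y j)) := by
    rw [Finset.sum_comm]
    refine Finset.sum_congr rfl fun j _ => ?_
    simp only [mulVec, dotProduct, blockNorms, of_apply, transpose_apply]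
    rw [Finset.sum_div, Finset.sum_mul]
    exact Finset.sum_congr rfl fun i _ => by rw [inv_div]; ring
  rw [h1, h2, h3, ← Finset.sum_add_distrib]
  refine Finset.sum_le_sum fun i _ => ?_
  rw [← Finset.sum_add_distrib]
  refine Finset.sum_le_sum fun j _ => ?_
  rw [← mul_add]
  -- The Young weight `t j / s i` makes the two sums collapse to `(|X| t)ᵢ / sᵢ` and `(|X|ᵀ s)ⱼ /
  -- tⱼ`.
  exact two_mul_dotProduct_mulVec_le _ _ _ (div_pos (ht j) (hs i))

/-- The norms of the off-diagonal blocks. -/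
noncomputable def offNorms (A : Matrix (Σ i, Fin (r i)) (Σ i, Fin (r i)) ℝ) : Matrix (Fin a) (Fin a) ℝ :=
  of fun i j => if i = j then 0 else ‖block A i j‖

theorem blockNorms_nonneg (X : Matrix (Σ i, Fin (r i)) (Σ j, Fin (c j)) ℝ) (i : Fin a) (j : Fin b) :
    0 ≤ blockNorms X i j := norm_nonneg (block X i j)

theorem offNorms_nonneg (A : Matrix (Σ i, Fin (r i)) (Σ i, Fin (r i)) ℝ) (i j : Fin a) :
    0 ≤ offNorms A i j := by
  simp only [offNorms, of_apply]
  split_ifs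
  · exact le_rfl
  · exact norm_nonneg _

theorem blockNorms_sub_blockDiagonal' (A : Matrix (Σ i, Fin (r i)) (Σ i, Fin (r i)) ℝ) :
    blockNorms (A - blockDiagonal' fun i => block A i i) = offNorms A := by
  ext i j
  simp only [blockNorms, offNorms, of_apply]
  split_ifs with h
  · subst h
    rw [norm_eq_zero]
    ext s t
    simp [block, blockDiagonal'_apply_eq]
  · congr 1
    ext s t
    simp [block, blockDiagonal'_apply_ne _ _ _ h]

end Blocks

/-! ### From the comparison system to block certificates -/

section Certificate
variable {n n₁ n₂ : ℕ} {k : Fin n → ℕ} {m : Fin n₁ → ℕ} {p : Fin n₂ → ℕ}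
  {A : Matrix (Σ i, Fin (k i)) (Σ i, Fin (k i)) ℝ}
  {B : Matrix (Σ i, Fin (k i)) (Σ l, Fin (m l)) ℝ}
  {C : Matrix (Σ q, Fin (p q)) (Σ i, Fin (k i)) ℝ}
  {D : Matrix (Σ q, Fin (p q)) (Σ l, Fin (m l)) ℝ} {δ : ℝ}
  {P : ∀ i, Matrix (Fin (k i)) (Fin (k i)) ℝ}
  {x z : Fin n → ℝ} {u : Fin n₁ → ℝ} {w : Fin n₂ → ℝ}

/-- Positive vectors and block matrices certifying the gain bound `δ` block by block. -/
structure Certificate (A : Matrix (Σ i, Fin (k i)) (Σ i, Fin (k i)) ℝ)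
    (B : Matrix (Σ i, Fin (k i)) (Σ l, Fin (m l)) ℝ)
    (C : Matrix (Σ q, Fin (p q)) (Σ i, Fin (k i)) ℝ)
    (D : Matrix (Σ q, Fin (p q)) (Σ l, Fin (m l)) ℝ) (δ : ℝ)
    (P : ∀ i, Matrix (Fin (k i)) (Fin (k i)) ℝ)
    (x z : Fin n → ℝ) (u : Fin n₁ → ℝ) (w : Fin n₂ → ℝ) : Prop where
  x_pos : ∀ i, 0 < x i
  z_pos : ∀ i, 0 < z i
  u_pos : ∀ i, 0 < u i
  w_pos : ∀ i, 0 < w i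
  posDef : ∀ i, (P i).PosDef
  output : ∀ q, (blockNorms C *ᵥ x) q + (blockNorms D *ᵥ u) q ≤ w q
  input : ∀ l, ((blockNorms B)ᵀ *ᵥ z) l + ((blockNorms D)ᵀ *ᵥ w) l < δ ^ 2 * u l
  state : ∀ i v, v ≠ 0 → 2 * ((P i *ᵥ v) ⬝ᵥ (block A i i *ᵥ v))
    + (((offNorms A)ᵀ *ᵥ z) i + ((blockNorms C)ᵀ *ᵥ w) i) / x i * (v ⬝ᵥ v)
    + ((offNorms A *ᵥ x) i + (blockNorms B *ᵥ u) i) / z i * ((P i *ᵥ v) ⬝ᵥ (P i *ᵥ v)) < 0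

/-- The output is handled by writing `Y·Y = 2 Y·(C X + D U) - Y·Y`: after Young's inequality the `Y`
terms cost at most one `Y·Y`, by the condition `output`. -/
theorem Certificate.dissipation (h : Certificate A B C D δ P x z u w)
    (X : (Σ i, Fin (k i)) → ℝ) (U : (Σ l, Fin (m l)) → ℝ) :
    2 * ((blockDiagonal' P *ᵥ X) ⬝ᵥ (A *ᵥ X + B *ᵥ U)) + (C *ᵥ X + D *ᵥ U) ⬝ᵥ (C *ᵥ X + D *ᵥ U)
      ≤ δ ^ 2 * (U ⬝ᵥ U) ∧
    (X ≠ 0 →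
      2 * ((blockDiagonal' P *ᵥ X) ⬝ᵥ (A *ᵥ X + B *ᵥ U)) + (C *ᵥ X + D *ᵥ U) ⬝ᵥ (C *ᵥ X + D *ᵥ U)
        < δ ^ 2 * (U ⬝ᵥ U)) := by
  set Q := blockDiagonal' P *ᵥ X with hQ
  set Y := C *ᵥ X + D *ᵥ U with hY
  set A₀ := blockDiagonal' fun i => block A i i
  have hQi : ∀ i, blockVec Q i = P i *ᵥ blockVec X i := blockVec_blockDiagonal'_mulVec P X
  have hA : A *ᵥ X = A₀ *ᵥ X + (A - A₀) *ᵥ X := by rw [sub_mulVec]; abel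
  have hA₀ : Q ⬝ᵥ A₀ *ᵥ X = ∑ i, (P i *ᵥ blockVec X i) ⬝ᵥ (block A i i *ᵥ blockVec X i) := by
    rw [dotProduct_eq_sum_blockVec]
    refine Finset.sum_congr rfl fun i _ => ?_
    rw [hQi, blockVec_blockDiagonal'_mulVec]
  have h1 := two_mul_dotProduct_mulVec_le_blocks (A - A₀) h.z_pos h.x_pos Q X
  have h2 := two_mul_dotProduct_mulVec_le_blocks B h.z_pos h.u_pos Q U
  have h3 := two_mul_dotProduct_mulVec_le_blocks C h.w_pos h.x_pos Y X
  have h4 := two_mul_dotProduct_mulVec_le_blocks D h.w_pos h.u_pos Y U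
  rw [blockNorms_sub_blockDiagonal'] at h1
  have hYY : Y ⬝ᵥ Y = Y ⬝ᵥ C *ᵥ X + Y ⬝ᵥ D *ᵥ U := by rw [← dotProduct_add]
  have hout : ∑ q, (blockNorms C *ᵥ x) q / w q * (blockVec Y q ⬝ᵥ blockVec Y q)
      + ∑ q, (blockNorms D *ᵥ u) q / w q * (blockVec Y q ⬝ᵥ blockVec Y q) ≤ Y ⬝ᵥ Y := by
    rw [dotProduct_eq_sum_blockVec Y Y, ← Finset.sum_add_distrib]
    refine Finset.sum_le_sum fun q _ => ?_
    rw [← add_mul, ← add_div]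
    refine mul_le_of_le_one_left (dotProduct_self_nonneg' _) ?_
    rw [div_le_one (h.w_pos q)]
    exact h.output q
  have hin : ∑ l, ((blockNorms B)ᵀ *ᵥ z) l / u l * (blockVec U l ⬝ᵥ blockVec U l)
      + ∑ l, ((blockNorms D)ᵀ *ᵥ w) l / u l * (blockVec U l ⬝ᵥ blockVec U l)
      ≤ δ ^ 2 * (U ⬝ᵥ U) := by
    rw [dotProduct_eq_sum_blockVec U U, ← Finset.sum_add_distrib, Finset.mul_sum]
    refine Finset.sum_le_sum fun l _ => ?_
    rw [← add_mul, ← add_div]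
    refine mul_le_mul_of_nonneg_right ?_ (dotProduct_self_nonneg' _)
    rw [div_le_iff₀ (h.u_pos l)]
    exact (h.input l).le
  let T : Fin n → ℝ := fun i => 2 * ((P i *ᵥ blockVec X i) ⬝ᵥ (block A i i *ᵥ blockVec X i))
    + (((offNorms A)ᵀ *ᵥ z) i + ((blockNorms C)ᵀ *ᵥ w) i) / x i * (blockVec X i ⬝ᵥ blockVec X i)
    + ((offNorms A *ᵥ x) i + (blockNorms B *ᵥ u) i) / z i *
      ((P i *ᵥ blockVec X i) ⬝ᵥ (P i *ᵥ blockVec X i))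
  have hT : ∀ i, T i ≤ 0 := fun i => by
    by_cases hv : blockVec X i = 0
    · simp [T, hv]
    · exact (h.state i _ hv).le
  have hsum : ∑ i, T i = 2 * (Q ⬝ᵥ A₀ *ᵥ X)
      + (∑ i, (offNorms A *ᵥ x) i / z i * (blockVec Q i ⬝ᵥ blockVec Q i)
        + ∑ i, ((offNorms A)ᵀ *ᵥ z) i / x i * (blockVec X i ⬝ᵥ blockVec X i))
      + ∑ i, (blockNorms B *ᵥ u) i / z i * (blockVec Q i ⬝ᵥ blockVec Q i)
      + ∑ i, ((blockNorms C)ᵀ *ᵥ w) i / x i * (blockVec X i ⬝ᵥ blockVec X i) := by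
    rw [hA₀, Finset.mul_sum]
    simp only [← Finset.sum_add_distrib, hQi, T]
    exact Finset.sum_congr rfl fun i _ => by ring
  have hmain : 2 * (Q ⬝ᵥ (A *ᵥ X + B *ᵥ U)) + Y ⬝ᵥ Y ≤ ∑ i, T i + δ ^ 2 * (U ⬝ᵥ U) := by
    rw [hA, dotProduct_add, dotProduct_add]
    linarith
  have hle : ∑ i, T i ≤ 0 := Finset.sum_nonpos fun i _ => hT i
  refine ⟨by linarith, fun hX => ?_⟩
  obtain ⟨i, hi⟩ := exists_blockVec_ne_zero hX
  have hlt : ∑ i, T i < 0 := Finset.sum_neg' (fun i _ => hT i) ⟨i, Finset.mem_univ i, h.state i _ hi⟩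
  linarith

theorem inv_smul_one {ι : Type*} [Fintype ι] [DecidableEq ι] (c : ℝ) :
    (c • (1 : Matrix ι ι ℝ))⁻¹ = c⁻¹ • 1 := by
  by_cases hc : c = 0
  · simp [hc]
  · exact inv_eq_right_inv (by simp [smul_smul, hc])

theorem form_scaled_le {ι κ : Type*} [Fintype ι] [DecidableEq ι] [Fintype κ] [DecidableEq κ]
    (X : Matrix ι κ ℝ) (s t : ℝ) (ht : 0 ≤ t / s) (v : κ → ℝ) :
    v ⬝ᵥ (Xᵀ * ((‖X‖ * s / t) • (1 : Matrix ι ι ℝ))⁻¹ * X) *ᵥ v ≤ ‖X‖ * t / s * (v ⬝ᵥ v) := by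
  have e : v ⬝ᵥ (Xᵀ * ((‖X‖ * s / t) • (1 : Matrix ι ι ℝ))⁻¹ * X) *ᵥ v
      = (‖X‖ * s / t)⁻¹ * ((X *ᵥ v) ⬝ᵥ (X *ᵥ v)) := by
    rw [inv_smul_one, Matrix.mul_smul, Matrix.mul_one, Matrix.smul_mul, smul_mulVec,
      dotProduct_smul, smul_eq_mul, ← mulVec_mulVec, dotProduct_mulVec_eq_transpose Xᵀ,
      transpose_transpose]
  rw [e]
  -- For a zero block the scaling matrix is zero and so is its inverse by convention.
  by_cases hX : ‖X‖ = 0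
  · simp [hX]
  · have h1 := mulVec_dotProduct_self_le X v
    have h2 : (‖X‖ * s / t)⁻¹ = ‖X‖⁻¹ * (t / s) := by rw [inv_div, div_eq_mul_inv, mul_inv]; ring
    rw [h2]
    have h3 : 0 ≤ ‖X‖⁻¹ * (t / s) := mul_nonneg (inv_nonneg.2 (norm_nonneg _)) ht
    calc _ ≤ ‖X‖⁻¹ * (t / s) * (‖X‖ ^ 2 * (v ⬝ᵥ v)) := mul_le_mul_of_nonneg_left h1 h3
      _ = (‖X‖⁻¹ * ‖X‖) * ‖X‖ * t / s * (v ⬝ᵥ v) := by ring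
      _ = _ := by rw [inv_mul_cancel₀ hX, one_mul]

theorem posDef_smul_one {ι : Type*} [Fintype ι] [DecidableEq ι] {c : ℝ} (hc : 0 < c) :
    (c • (1 : Matrix ι ι ℝ)).PosDef := PosDef.one.smul hc

theorem posSemidef_smul_one {ι : Type*} [Fintype ι] [DecidableEq ι] {c : ℝ} (hc : 0 ≤ c) :
    (c • (1 : Matrix ι ι ℝ)).PosSemidef := PosSemidef.one.smul hc

theorem form_finset_sum {ι κ : Type*} [Fintype ι] (s : Finset κ) (f : κ → Matrix ι ι ℝ)
    (v : ι → ℝ) : v ⬝ᵥ (∑ j ∈ s, f j) *ᵥ v = ∑ j ∈ s, v ⬝ᵥ f j *ᵥ v := by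
  rw [Matrix.sum_mulVec, dotProduct_sum]

theorem Certificate.blockwiseSolvable (h : Certificate A B C D δ P x z u w) :
    BlockwiseSolvable A B C D δ := by
  classical
  have hx := h.x_pos
  have hz := h.z_pos
  have hu := h.u_pos
  have hw := h.w_pos
  have pos : ∀ {r s t : ℝ}, r ≠ 0 → 0 ≤ r → 0 < s → 0 < t → 0 < r * s / t :=
    fun h0 h1 h2 h3 => div_pos (mul_pos (lt_of_le_of_ne h1 h0.symm) h2) h3
  have nng : ∀ {r s t : ℝ}, 0 ≤ r → 0 < s → 0 < t → 0 ≤ r * s / t :=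
    fun h1 h2 h3 => div_nonneg (mul_nonneg h1 h2.le) h3.le
  -- Each scalar is a block norm times a ratio of certificate entries, so the sums of multipliers,
  -- and of their inverses against the blocks, become the rows of `output`, `input` and `state`. The
  -- products of the `Υ` and `Λ` scalars equal `‖D q l‖²`, as the 2×2 condition needs.
  refine ⟨P, fun q i => (‖block C q i‖ * x i / w q) • 1, fun i l => (‖block B i l‖ * z i / u l) • 1,
    fun i j => (‖block A i j‖ * z i / x j) • 1, fun q l => (‖block D q l‖ * w q / u l) • 1,
    fun q l => (‖block D q l‖ * u l / w q) • 1, h.posDef,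
    fun q i => posSemidef_smul_one (nng (norm_nonneg _) (hx i) (hw q)),
    fun i l => posSemidef_smul_one (nng (norm_nonneg _) (hz i) (hu l)),
    fun i j => posSemidef_smul_one (nng (norm_nonneg _) (hz i) (hx j)),
    fun q l => posSemidef_smul_one (nng (norm_nonneg _) (hw q) (hu l)),
    fun q l => posSemidef_smul_one (nng (norm_nonneg _) (hu l) (hw q)),
    fun q i h0 => posDef_smul_one (pos h0 (norm_nonneg _) (hx i) (hw q)),
    fun i l h0 => posDef_smul_one (pos h0 (norm_nonneg _) (hz i) (hu l)),
    fun i j h0 _ => posDef_smul_one (pos h0 (norm_nonneg _) (hz i) (hx j)),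
    fun i => ?_, fun q l => ?_, fun q => ?_, fun l => ?_⟩
  · have hP : (P i)ᵀ = P i := (h.posDef i).transpose_eq
    refine posDef_of_forms ?_ fun v hv => ?_
    · simp only [inv_smul_one, transpose_neg, transpose_add, transpose_mul, transpose_sum,
        transpose_smul, transpose_one, transpose_transpose, hP, Matrix.mul_assoc]
      rw [add_comm (P i * block A i i)]
    · have hst := h.state i v hv
      have e1 : v ⬝ᵥ (P i * block A i i) *ᵥ v = (P i *ᵥ v) ⬝ᵥ (block A i i *ᵥ v) := by
        rw [← mulVec_mulVec, dotProduct_mulVec_eq_transpose, hP]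
      have e2 : v ⬝ᵥ ((block A i i)ᵀ * P i) *ᵥ v = (P i *ᵥ v) ⬝ᵥ (block A i i *ᵥ v) := by
        rw [← mulVec_mulVec, dotProduct_mulVec_eq_transpose, transpose_transpose, dotProduct_comm]
      have e3 : v ⬝ᵥ (∑ j with j ≠ i, (‖block A j i‖ * z j / x i) • (1 : Matrix (Fin (k i)) (Fin (k i)) ℝ)) *ᵥ v
          = ((offNorms A)ᵀ *ᵥ z) i / x i * (v ⬝ᵥ v) := by
        simp only [form_finset_sum, smul_mulVec, one_mulVec, dotProduct_smul, smul_eq_mul]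
        rw [← Finset.sum_mul, ← Finset.sum_div, Finset.sum_filter]
        congr 2
        refine Finset.sum_congr rfl fun j _ => ?_
        by_cases hj : j = i <;> simp [offNorms, hj]
      have e4 : v ⬝ᵥ (∑ q with ‖block C q i‖ ≠ 0, (block C q i)ᵀ *
          ((‖block C q i‖ * x i / w q) • (1 : Matrix (Fin (p q)) (Fin (p q)) ℝ))⁻¹ *
          block C q i) *ᵥ v ≤ ((blockNorms C)ᵀ *ᵥ w) i / x i * (v ⬝ᵥ v) := by
        rw [form_finset_sum]
        simp only [mulVec, dotProduct, blockNorms, of_apply, transpose_apply]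
        rw [Finset.sum_div, Finset.sum_mul]
        refine (Finset.sum_le_sum fun q _ => form_scaled_le (block C q i) (x i) (w q)
          (div_pos (hw q) (hx i)).le v).trans ?_
        exact Finset.sum_le_sum_of_subset_of_nonneg (Finset.filter_subset _ _) fun q _ _ =>
          mul_nonneg (nng (norm_nonneg _) (hw q) (hx i)) (dotProduct_self_nonneg' v)
      have e5 : (P i *ᵥ v) ⬝ᵥ (∑ j with ‖block A i j‖ ≠ 0 ∧ j ≠ i, block A i j *
          ((‖block A i j‖ * z i / x j) • (1 : Matrix (Fin (k j)) (Fin (k j)) ℝ))⁻¹ *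
          (block A i j)ᵀ) *ᵥ (P i *ᵥ v)
          ≤ (offNorms A *ᵥ x) i / z i * ((P i *ᵥ v) ⬝ᵥ (P i *ᵥ v)) := by
        rw [form_finset_sum]
        have : ∀ j, (P i *ᵥ v) ⬝ᵥ (block A i j *
          ((‖block A i j‖ * z i / x j) • (1 : Matrix (Fin (k j)) (Fin (k j)) ℝ))⁻¹ *
          (block A i j)ᵀ) *ᵥ (P i *ᵥ v)
            ≤ ‖block A i j‖ * x j / z i * ((P i *ᵥ v) ⬝ᵥ (P i *ᵥ v)) := fun j => by
          have := form_scaled_le (block A i j)ᵀ (z i) (x j) (div_pos (hx j) (hz i)).le (P i *ᵥ v)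
          rwa [l2_opNorm_transpose, transpose_transpose] at this
        refine (Finset.sum_le_sum fun j _ => this j).trans ?_
        rw [← Finset.sum_mul, ← Finset.sum_div]
        refine mul_le_mul_of_nonneg_right (div_le_div_of_nonneg_right ?_ (hz i).le)
          (dotProduct_self_nonneg' _)
        rw [Finset.sum_filter]
        refine Finset.sum_le_sum fun j _ => ?_
        by_cases hj : i = j
        · simp [offNorms, hj]
        · have : 0 ≤ ‖block A i j‖ * x j := mul_nonneg (norm_nonneg _) (hx j).le
          simp only [offNorms, of_apply, if_neg hj]
          split_ifs <;> simp [this]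
      have e6 : (P i *ᵥ v) ⬝ᵥ (∑ l with ‖block B i l‖ ≠ 0, block B i l *
          ((‖block B i l‖ * z i / u l) • (1 : Matrix (Fin (m l)) (Fin (m l)) ℝ))⁻¹ *
          (block B i l)ᵀ) *ᵥ (P i *ᵥ v)
          ≤ (blockNorms B *ᵥ u) i / z i * ((P i *ᵥ v) ⬝ᵥ (P i *ᵥ v)) := by
        rw [form_finset_sum]
        have : ∀ l, (P i *ᵥ v) ⬝ᵥ (block B i l *
          ((‖block B i l‖ * z i / u l) • (1 : Matrix (Fin (m l)) (Fin (m l)) ℝ))⁻¹ *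
          (block B i l)ᵀ) *ᵥ (P i *ᵥ v)
            ≤ ‖block B i l‖ * u l / z i * ((P i *ᵥ v) ⬝ᵥ (P i *ᵥ v)) := fun l => by
          have := form_scaled_le (block B i l)ᵀ (z i) (u l) (div_pos (hu l) (hz i)).le (P i *ᵥ v)
          rwa [l2_opNorm_transpose, transpose_transpose] at this
        refine (Finset.sum_le_sum fun l _ => this l).trans ?_
        rw [← Finset.sum_mul, ← Finset.sum_div]
        refine mul_le_mul_of_nonneg_right (div_le_div_of_nonneg_right ?_ (hz i).le)
          (dotProduct_self_nonneg' _)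
        exact Finset.sum_le_sum_of_subset_of_nonneg (Finset.filter_subset _ _) fun l _ _ =>
          mul_nonneg (norm_nonneg _) (hu l).le
      have e7 : ∀ M : Matrix (Fin (k i)) (Fin (k i)) ℝ,
          v ⬝ᵥ (P i * M * P i) *ᵥ v = (P i *ᵥ v) ⬝ᵥ M *ᵥ (P i *ᵥ v) := fun M => by
        rw [Matrix.mul_assoc, ← mulVec_mulVec, ← mulVec_mulVec, dotProduct_mulVec_eq_transpose, hP]
      rw [neg_mulVec, dotProduct_neg, add_mulVec, add_mulVec, add_mulVec, add_mulVec,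
        dotProduct_add, dotProduct_add, dotProduct_add, dotProduct_add, e1, e2, e3, e7, add_mulVec,
        dotProduct_add]
      rw [add_div, add_mul, add_div, add_mul] at hst
      linarith
  · refine posSemidef_of_forms ?_ fun v => ?_
    · simp [fromBlocks_transpose]
    · have h1 := two_mul_dotProduct_mulVec_le (block D q l) (v ∘ Sum.inr) (v ∘ Sum.inl)
        (div_pos (hu l) (hw q))
      rw [fromBlocks_mulVec]
      conv_rhs => rw [← Sum.elim_comp_inl_inr v, sumElim_dotProduct_sumElim]
      simp only [Sum.elim_comp_inl, Sum.elim_comp_inr, dotProduct_add, smul_mulVec, one_mulVec,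
        dotProduct_smul, neg_mulVec, dotProduct_neg, smul_eq_mul,
        dotProduct_mulVec_eq_transpose (block D q l)ᵀ, transpose_transpose]
      rw [dotProduct_comm (block D q l *ᵥ (v ∘ Sum.inl))]
      rw [inv_div, mul_add, ← mul_assoc, ← mul_assoc, ← mul_div_assoc, ← mul_div_assoc] at h1
      linarith
  · have e : (1 : Matrix (Fin (p q)) (Fin (p q)) ℝ) - (∑ i, (‖block C q i‖ * x i / w q) • 1
        + ∑ l, (‖block D q l‖ * u l / w q) • 1)
        = (1 - ((blockNorms C *ᵥ x) q + (blockNorms D *ᵥ u) q) / w q) • 1 := by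
      rw [← Finset.sum_smul, ← Finset.sum_smul, ← Finset.sum_div, ← Finset.sum_div, ← add_smul,
        ← add_div, sub_smul, one_smul]
      rfl
    rw [e]
    refine posSemidef_smul_one ?_
    rw [sub_nonneg, div_le_one (hw q)]
    exact h.output q
  · have e : δ ^ 2 • (1 : Matrix (Fin (m l)) (Fin (m l)) ℝ)
        - (∑ i, (‖block B i l‖ * z i / u l) • 1 + ∑ q, (‖block D q l‖ * w q / u l) • 1)
        = (δ ^ 2 - (((blockNorms B)ᵀ *ᵥ z) l + ((blockNorms D)ᵀ *ᵥ w) l) / u l) • 1 := by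
      rw [← Finset.sum_smul, ← Finset.sum_smul, ← Finset.sum_div, ← Finset.sum_div, ← add_smul,
        ← add_div, sub_smul]
      rfl
    rw [e]
    refine posDef_smul_one ?_
    rw [sub_pos, div_lt_iff₀ (hu l)]
    exact h.input l

theorem exists_certificate (hA : ∀ i, IsHurwitz (block A i i)) {F : Matrix (Fin n) (Fin n) ℝ}
    (hF : F = comparisonM A ∨ F = comparisonN A) (hFstab : IsHurwitz F)
    (hδ : ‖blockNorms C * (-F)⁻¹ * blockNorms B + blockNorms D‖ < δ) :
    ∃ P x z u w, Certificate A B C D δ P x z u w := by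
  have hoffF : ∀ i j, i ≠ j → F i j = offNorms A i j := by
    intro i j hij
    rcases hF with rfl | rfl <;> simp [comparisonM, comparisonN, offNorms, hij]
  have hoff : ∀ i j, i ≠ j → 0 ≤ F i j := fun i j hij =>
    (offNorms_nonneg A i j).trans_eq (hoffF i j hij).symm
  obtain ⟨x, z, u, w, hx, hz, hu, hw, h1, h2, h3, h4⟩ := exists_positive_certificate hoff
    (fun s hs => hFstab.det_ne_zero hs) (blockNorms_nonneg B) (blockNorms_nonneg C)
    (blockNorms_nonneg D) hδ
  have hFd : F = diagonal (fun i => F i i) + offNorms A := by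
    ext i j
    by_cases hij : i = j
    · subst hij; simp [offNorms]
    · simp [hij, hoffF i j hij]
  have hFx : ∀ i, (F *ᵥ x) i = F i i * x i + (offNorms A *ᵥ x) i := fun i => by
    conv_lhs => rw [hFd]
    rw [add_mulVec, Pi.add_apply, mulVec_diagonal]
  have hFz : ∀ i, (Fᵀ *ᵥ z) i = F i i * z i + ((offNorms A)ᵀ *ᵥ z) i := fun i => by
    conv_lhs => rw [hFd]
    rw [transpose_add, diagonal_transpose, add_mulVec, Pi.add_apply, mulVec_diagonal]
  have hkey : ∀ i, ∃ P : Matrix (Fin (k i)) (Fin (k i)) ℝ, P.PosDef ∧ ∀ v, v ≠ 0 →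
      2 * ((P *ᵥ v) ⬝ᵥ (block A i i *ᵥ v))
      + (((offNorms A)ᵀ *ᵥ z) i + ((blockNorms C)ᵀ *ᵥ w) i) / x i * (v ⬝ᵥ v)
      + ((offNorms A *ᵥ x) i + (blockNorms B *ᵥ u) i) / z i * ((P *ᵥ v) ⬝ᵥ (P *ᵥ v)) < 0 := by
    intro i
    set α := ((offNorms A)ᵀ *ᵥ z) i + ((blockNorms C)ᵀ *ᵥ w) i with hα
    set β := (offNorms A *ᵥ x) i + (blockNorms B *ᵥ u) i with hβ
    have hα1 : α / z i < -F i i := by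
      rw [div_lt_iff₀ (hz i)]; have := h3 i; rw [hFz] at this; linarith
    have hβ1 : β / x i < -F i i := by
      rw [div_lt_iff₀ (hx i)]; have := h1 i; rw [hFx] at this; linarith
    have hβ0 : 0 ≤ β := add_nonneg
      (mulVec_nonneg_entries (offNorms_nonneg A) (fun j => (hx j).le) i)
      (mulVec_nonneg_entries (blockNorms_nonneg B) (fun j => (hu j).le) i)
    -- One `c` below the damping rate `-F i i` dominates both the column cost `α / z i` and the row
    -- cost `β / x i`; scaling `Q` by `z i / x i` below balances the two.
    obtain ⟨c, hc1, hc2⟩ := exists_between (max_lt hα1 hβ1)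
    have hc : 0 < c := ((div_nonneg hβ0 (hx i).le).trans (le_max_right _ _)).trans_lt hc1
    have hcα : α < c * z i := (div_lt_iff₀ (hz i)).1 ((le_max_left _ _).trans_lt hc1)
    have hcβ : β < c * x i := (div_lt_iff₀ (hx i)).1 ((le_max_right _ _).trans_lt hc1)
    obtain ⟨Q, hQ, hQv⟩ := exists_block_solution (hA i) hc hc2 (by
      rcases hF with rfl | rfl
      · left; simp [comparisonM]
      · right; simp [comparisonN])
    have hr : 0 < z i / x i := div_pos (hz i) (hx i)
    refine ⟨(z i / x i) • Q, hQ.smul hr, fun v hv => ?_⟩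
    have h5 := mul_neg_of_pos_of_neg hr (hQv v hv)
    have h6 : α / x i * (v ⬝ᵥ v) ≤ z i / x i * (c * (v ⬝ᵥ v)) := by
      rw [← mul_assoc]
      refine mul_le_mul_of_nonneg_right ?_ (dotProduct_self_nonneg' v)
      rw [div_mul_eq_mul_div, mul_comm (z i)]
      exact div_le_div_of_nonneg_right hcα.le (hx i).le
    have h7 : β / z i * (z i / x i * (z i / x i * ((Q *ᵥ v) ⬝ᵥ (Q *ᵥ v))))
        ≤ z i / x i * (c * ((Q *ᵥ v) ⬝ᵥ (Q *ᵥ v))) := by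
      have e : β / z i * (z i / x i * (z i / x i * ((Q *ᵥ v) ⬝ᵥ (Q *ᵥ v))))
          = z i / x i * (β / x i * ((Q *ᵥ v) ⬝ᵥ (Q *ᵥ v))) := by
        have := (hz i).ne'
        field_simp
      rw [e]
      refine mul_le_mul_of_nonneg_left ?_ hr.le
      exact mul_le_mul_of_nonneg_right ((le_max_right _ _).trans hc1.le) (dotProduct_self_nonneg' _)
    simp only [smul_mulVec, smul_dotProduct, dotProduct_smul, smul_eq_mul]
    linarith
  choose P hP hPv using hkey
  exact ⟨P, x, z, u, w, hx, hz, hu, hw, hP, h2, h4, hPv⟩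

end Certificate

/-- The static gain is the transfer function at `ω = 0`; the supremum dominates it because the
family is bounded. -/
theorem norm_static_gain_lt {ι μ π : Type*} [Fintype ι] [DecidableEq ι] [Fintype μ] [DecidableEq μ]
    [Fintype π] [DecidableEq π] {F : Matrix ι ι ℝ} {G : Matrix ι μ ℝ} {H : Matrix π ι ℝ}
    {J : Matrix π μ ℝ} (hF : IsHurwitz F) {δ : ℝ} (hδ : hinfNorm (transferFun F G H J) < δ) :
    ‖H * (-F)⁻¹ * G + J‖ < δ := by
  obtain ⟨M, hM⟩ := hF.exists_resolvent_bound
  have hbdd : BddAbove (Set.range fun ω : ℝ => ‖transferFun F G H J (Complex.I * (ω : ℂ))‖) := by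
    refine ⟨‖H.map Complex.ofReal‖ * M * ‖G.map Complex.ofReal‖ + ‖J.map Complex.ofReal‖, ?_⟩
    rintro _ ⟨ω, rfl⟩
    refine (norm_add_le _ _).trans (add_le_add_left ?_ _)
    refine (l2_opNorm_mul _ _).trans (mul_le_mul_of_nonneg_right ?_ (norm_nonneg _))
    exact (l2_opNorm_mul _ _).trans (mul_le_mul_of_nonneg_left (hM ω) (norm_nonneg _))
  have h1 := le_ciSup hbdd 0
  rw [transferFun_zero G H J (isUnit_det_neg fun s hs => hF.det_ne_zero hs)] at h1
  exact ((l2_opNorm_le_map_ofReal _).trans h1).trans_lt hδ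

end BlockRiccati

theorem mainTheorem4 {n n₁ n₂ : ℕ}
    (k : Fin n → ℕ) (m : Fin n₁ → ℕ) (p : Fin n₂ → ℕ) (hk : ∀ i, 0 < k i)
    (A : Matrix (Σ i, Fin (k i)) (Σ i, Fin (k i)) ℝ)
    (B : Matrix (Σ i, Fin (k i)) (Σ l, Fin (m l)) ℝ)
    (C : Matrix (Σ q, Fin (p q)) (Σ i, Fin (k i)) ℝ)
    (D : Matrix (Σ q, Fin (p q)) (Σ l, Fin (m l)) ℝ)
    (hA : ∀ i, IsHurwitz (block A i i))
    (F : Matrix (Fin n) (Fin n) ℝ) (hF : F = comparisonM A ∨ F = comparisonN A)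
    (hFstab : IsHurwitz F) (δ : ℝ)
    (hδ : hinfNorm (transferFun F (blockNorms B) (blockNorms C) (blockNorms D)) < δ) :
    BlockwiseSolvable A B C D δ ∧
    IsHurwitz A ∧ hinfNorm (transferFun A B C D) < δ ∧
    ‖D‖ < δ ∧
    ∃ P : ∀ i, Matrix (Fin (k i)) (Fin (k i)) ℝ,
      (∀ i, (P i).PosDef) ∧
      (-(riccati A B C D δ (Matrix.blockDiagonal' P))).PosDef := by
  -- The supremum over `ω` and the feedthrough norm only inherit non-strict bounds, so the
  -- certificate is built for a smaller gain `δ'`.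
  obtain ⟨δ', hδ', hδδ⟩ := exists_between hδ
  have hδ0 : 0 ≤ δ' := (Real.iSup_nonneg fun _ => norm_nonneg _).trans hδ'.le
  have hsq : δ' ^ 2 ≤ δ ^ 2 := pow_le_pow_left₀ hδ0 hδδ.le 2
  obtain ⟨P, x, z, u, w, h⟩ := exists_certificate hA hF hFstab (norm_static_gain_lt hFstab hδ')
  have hdiss : Dissipative A B C D (Matrix.blockDiagonal' P) δ' :=
    fun X U => (h.dissipation X U).1
  have hPt : (Matrix.blockDiagonal' P)ᵀ = Matrix.blockDiagonal' P := by
    rw [Matrix.blockDiagonal'_transpose]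
    congr 1
    exact funext fun i => (h.posDef i).transpose_eq
  have hP : (Matrix.blockDiagonal' P).PosDef := posDef_of_forms hPt fun X hX => by
    obtain ⟨i, hi⟩ := exists_blockVec_ne_zero hX
    rw [dotProduct_eq_sum_blockVec]
    refine Finset.sum_pos' (fun j _ => ?_) ⟨i, Finset.mem_univ i, ?_⟩
    · rw [blockVec_blockDiagonal'_mulVec]
      simpa using (h.posDef j).posSemidef.dotProduct_mulVec_nonneg (blockVec X j)
    · rw [blockVec_blockDiagonal'_mulVec]
      exact (h.posDef i).form_pos hi
  have hAstab : IsHurwitz A := isHurwitz_of_lyapunov hP fun X hX => by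
    have h1 := (h.dissipation X 0).2 hX
    have h2 := dotProduct_self_nonneg' (C *ᵥ X)
    simp only [Matrix.mulVec_zero, add_zero, dotProduct_zero, mul_zero] at h1
    linarith
  have hD : ‖D‖ < δ := (hdiss.norm_feedthrough_le hδ0).trans_lt hδδ
  refine ⟨Certificate.blockwiseSolvable (P := P) (x := x) (z := z) (u := u) (w := w)
    { h with input := fun l => (h.input l).trans_le (mul_le_mul_of_nonneg_right hsq (h.u_pos l).le) },
    hAstab, ?_, hD, P, h.posDef, posDef_neg_riccati hPt hD fun X U hX => ?_⟩
  · exact (ciSup_le fun ω => hdiss.norm_transferFun_le hPt hδ0 hAstab ω).trans_lt hδδ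
  · exact ((h.dissipation X U).2 hX).trans_le
      (mul_le_mul_of_nonneg_right hsq (dotProduct_self_nonneg' U))
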